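/- All graphs are finite and simple. The energy $\mathscr{E}(G)$ of a graph $G$ is the sum of the absolute values of the eigenvalues of its adjacency matrix, counted with multiplicity ($0$ for the graph without vertices). The local energy of $G$ is $e(G)=\sum_{v\in V(G)}\bigl(\mathscr{E}(G)-\mathscr{E}(G-v)\bigr)$, where $G-v$ is obtained from $G$ by deleting the vertex $v$. Two graphs of the same order are locally equienergetic if they have the same local energy; a class of locally equienergetic graphs of order $n$ is the set of all graphs locally equienergetic to a given graph of order $n$, provided that this set contains at least two non-isomorphic graphs. Write $K_n$ for the complete graph and $C_n$ for the cycle on $n$ vertices, and $\cup$ for disjoint union. **Proposition.** There are exactly three classes of locally equienergetic graphs of order $6$. Up to isomorphism they are (i) $\{K_6,\ K_4\cup K_2,\ K_3\cup K_3,\ K_2\cup K_2\cup K_2\}$; (ii) $\{K_5\cup K_1,\ K_3\cup K_2\cup K_1,\ C_5\cup K_1\}$; (iii) $\{K_4\cup K_1\cup K_1,\ K_2\cup K_2\cup K_1\cup K_1\}$. The nine graphs listed are pairwise non-isomorphic. Thus two non-isomorphic graphs of order $6$ have the same local energy if and only if both are isomorphic to members of the same one of these three lists. -/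

import Mathlib

/-- A finite simple graph: a finite vertex type together with a simple graph on it. -/
structure FinGraph where
  V : Type
  fintypeV : Fintype V
  graph : SimpleGraph V

namespace FinGraph

instance (G : FinGraph) : Fintype G.V := G.fintypeV

/-- The number of vertices. -/
def order (G : FinGraph) : ℕ := Fintype.card G.V

/-- Two graphs are isomorphic. -/
def Iso (G H : FinGraph) : Prop := Nonempty (G.graph ≃g H.graph)

open Classical in
theorem isHermitian_adjMatrix (G : FinGraph) : (G.graph.adjMatrix ℝ).IsHermitian := by
  rw [Matrix.IsHermitian, Matrix.conjTranspose_eq_transpose_of_trivial]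
  exact G.graph.transpose_adjMatrix

open Classical in
/-- The energy: the sum of the absolute values of the eigenvalues of the adjacency matrix
(counted with multiplicity); it is `0` for the graph without vertices. -/
noncomputable def energy (G : FinGraph) : ℝ :=
  ∑ i, |G.isHermitian_adjMatrix.eigenvalues i|

open Classical in
/-- The graph obtained by deleting the vertex `v`. -/
noncomputable def deleteVertex (G : FinGraph) (v : G.V) : FinGraph where
  V := {w : G.V // w ≠ v}
  fintypeV := inferInstance
  graph := G.graph.induce {w | w ≠ v}

/-- The local energy of `G` at the vertex `v`. -/
noncomputable def localEnergyAt (G : FinGraph) (v : G.V) : ℝ :=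
  G.energy - (G.deleteVertex v).energy

/-- The local energy of `G`. -/
noncomputable def localEnergy (G : FinGraph) : ℝ :=
  ∑ v, G.localEnergyAt v

/-- Two graphs of the same order are locally equienergetic if their local energies agree. -/
def LocallyEquienergetic (G H : FinGraph) : Prop :=
  G.order = H.order ∧ G.localEnergy = H.localEnergy

/-- A class of locally equienergetic graphs of order `n`: all graphs that are locally
equienergetic to a given graph of order `n`, provided that at least two non-isomorphic graphs
occur among them. -/
def IsLocallyEquienergeticClass (n : ℕ) (S : Set FinGraph) : Prop :=
  ∃ G : FinGraph, G.order = n ∧ S = {F | F.LocallyEquienergetic G} ∧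
    ∃ H ∈ S, ¬ H.Iso G

/-- The complete graph on `n` vertices. -/
def K (n : ℕ) : FinGraph := ⟨Fin n, inferInstance, ⊤⟩

/-- The cycle on `n` vertices. -/
def C (n : ℕ) : FinGraph := ⟨Fin n, inferInstance, SimpleGraph.cycleGraph n⟩

/-- The disjoint union of two graphs. -/
instance : Union FinGraph := ⟨fun G H => ⟨G.V ⊕ H.V, inferInstance, G.graph ⊕g H.graph⟩⟩

/-- All graphs that are isomorphic to a member of the list `L`. -/
def upToIso (L : List FinGraph) : Set FinGraph := {F | ∃ G ∈ L, F.Iso G}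

end FinGraph

open FinGraph

/-!
The local energy is an isomorphism invariant, and there are 156 graphs on six vertices, so the
claim is a finite one. It compares real numbers, though, and the comparison has to be brought into
a form that the kernel can evaluate with natural numbers.

*Graphs.* A graph on `0, …, n - 1` is coded by its upper triangle, read column by column as a
binary number. Every graph is isomorphic to one with minimal code. As the leading bits of a
minimal code form a minimal code on one vertex less, all minimal codes are found by adding one
vertex at a time and discarding the codes that some involution decreases; this gives the list
`reps 6` (`exists_iso_ofCode`).

*Energies.* Deleting a vertex changes the spectrum in the same way as isolating it, up to an
eigenvalue `0` (`energy_deleteVertex_eq`), so only graphs on six vertices occur. The power sums of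
the eigenvalues are the numbers of closed walks, and Newton's identities yield the characteristic
polynomial (`exists_spectrum`, `newton_identities`). The eigenvalues sum to `0`, so the energy is
twice the sum of the positive ones. All six roots are real; Descartes' rule of signs, applied at a
point to the roots on either side of it, therefore bounds the number of roots beyond that point
from above and from below. By bisection, these counts enclose the sum of the positive roots
between rational numbers (`clampBounds_spec`, `energyBounds_spec`).

*Comparison.* The resulting enclosures of the local energies separate all pairs of graphs other
than those in one of the three lists (`allPairs_separated_reps`, `eq_or_sameClass`). On the lists
the local energy has the values `12`, `10` and `8` (`localEnergy_codes`). All eigenvalues involved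
are integers, and the enclosures are single points, except for `C₅ ∪ K₁`. There the spectra of
`C₅` and of the path `P₄` are written in terms of the golden ratio, and the local energy is
`5 * (E(C₅) - E(P₄)) = 10` (`localEnergy_pentagon`). Finally, the nine graphs are told apart by
their numbers of closed walks of lengths `2` and `3` (`pairwise_nine`).
-/

namespace SixVertex

/-- The value `f n`. Recursion on `n` makes the kernel reduce `n` to a numeral before it is
handed to `f`, so that it is not computed again at each of its occurrences. -/
def force {α : Type} (n : ℕ) (f : ℕ → α) : α := Nat.rec (f 0) (fun k _ => f (Nat.succ k)) n

/-! ### Codes of graphs, as computations -/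

/-- The value of a bit string, most significant bit first. -/
def val (l : List Bool) : ℕ := l.foldl (fun r b => 2 * r + b.toNat) 0

/-- The pairs `i < j < n`, ordered by `j` and then by `i`. -/
def pairs : ℕ → List (ℕ × ℕ)
  | 0 => []
  | n + 1 => pairs n ++ (List.range n).map fun i => (i, n)

/-- The code of the graph on `0, …, n - 1` with adjacency `f`: its upper triangle, read as a
binary number. -/
def code (n : ℕ) (f : ℕ → ℕ → Bool) : ℕ := val ((pairs n).map fun p => f p.1 p.2)

/-- The number of pairs `i < j < n`. -/
def tri (n : ℕ) : ℕ := Nat.div (Nat.mul n (Nat.pred n)) 2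

/-- The binary digit of `m` at position `i`. -/
def digit (m i : ℕ) : Bool := Nat.beq 1 (Nat.land 1 (Nat.shiftRight m i))

/-- The adjacency on `0, …, n - 1` of the graph with code `m`. -/
def adj (n m i j : ℕ) : Bool :=
  bif Nat.blt i j then digit m (Nat.sub (Nat.pred (tri n)) (Nat.add (tri j) i))
  else bif Nat.blt j i then digit m (Nat.sub (Nat.pred (tri n)) (Nat.add (tri i) j))
  else false

/-- Whether the bit string `f p`, for `p` in `l`, is lexicographically at most the string `g p`. -/
def lexLE (f g : ℕ × ℕ → Bool) : List (ℕ × ℕ) → Bool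
  | [] => true
  | p :: l => bif f p then (bif g p then lexLE f g l else false)
      else (bif g p then true else lexLE f g l)

/-- A product of transpositions, as a function. -/
def act (w : List (ℕ × ℕ)) (k : ℕ) : ℕ :=
  w.foldr (fun p k => bif Nat.beq k p.1 then p.2 else bif Nat.beq k p.2 then p.1 else k) k

/-- Some involutions of `0, …, 5`. They are chosen so that `reps` below keeps a single code for each
isomorphism class, 156 codes on six vertices, and they are ordered so that most other codes are
rejected early. The proofs only use that minimal codes are kept, which holds for any choice. -/
def involutions : List (List (ℕ × ℕ)) :=
  [[(0, 1)], [(1, 2)], [(2, 3)], [(3, 4)], [(0, 1), (2, 3)], [(0, 1), (3, 4)], [(0, 2), (1, 3)],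
    [(4, 5)], [(1, 2), (3, 4)], [(0, 1), (4, 5)], [(0, 2), (3, 5)], [(0, 4), (2, 5)],
    [(1, 2), (4, 5)], [(1, 3), (2, 4)], [(0, 4)], [(0, 1), (2, 4), (3, 5)],
    [(0, 3), (1, 4), (2, 5)]]

/-- None of the involutions that live on `0, …, n - 1` turns `m` into a smaller code. -/
def isReduced (n m : ℕ) : Bool :=
  (involutions.filter fun w => w.all fun p => Nat.blt p.1 n && Nat.blt p.2 n).all fun w =>
    lexLE (fun p => adj n m p.1 p.2) (fun p => adj n m (act w p.1) (act w p.2)) (pairs n)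

/-- Candidates for minimal codes on `n` vertices, built by adding one vertex at a time: `x` runs
over the possible neighbourhoods of the new vertex. -/
def reps : ℕ → List ℕ
  | 0 => [0]
  | n + 1 => (reps n).flatMap fun m => (List.range (2 ^ n)).foldr (fun x l =>
      force (Nat.add (Nat.mul m (2 ^ n)) x) fun c => bif isReduced (n + 1) c then c :: l else l) []

/-! ### Descartes' rule, as a computation -/

/-- The coefficients, highest first, of `x * X ^ n + (X + 1) * l + k`, where the list `l` of length
`n` stands for the polynomial with these coefficients. -/
def mulAdd (k : ℕ) : List ℕ → ℕ → List ℕ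
  | [], x => [Nat.add x k]
  | a :: l, x => Nat.add x a :: mulAdd k l a

/-- The coefficients of `l (X + 1)`, by Horner's scheme. All roots are decreased by `1`. -/
def shift (l : List ℕ) : List ℕ := l.foldl (fun r a => mulAdd a r 0) []

/-- Multiplication of the coefficient at position `i` by `2 ^ (k + i)`. All roots are doubled. -/
def scale : List ℕ → ℕ → List ℕ
  | [], _ => []
  | a :: l, k => Nat.shiftLeft a k :: scale l (Nat.succ k)

/-- The number of sign changes in the coefficients of `p - q`, after an earlier nonzero
coefficient; if `e` holds, in those of the polynomial with `-X` for `X`. The next coefficient of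
`p - q` continues the sign of the earlier one if it is positive and `s` holds, or negative and `s`
fails. -/
def varFrom (e : Bool) : List ℕ → List ℕ → Bool → ℕ
  | a :: p, b :: q, s =>
    bif Nat.beq a b then varFrom e p q (xor e s)
    else bif Nat.blt b a then
      (bif s then varFrom e p q (not e) else Nat.succ (varFrom e p q (not e)))
    else (bif s then Nat.succ (varFrom e p q e) else varFrom e p q e)
  | _, _, _ => 0

/-- The number of sign changes in the coefficients of `p - q` or, if `e` holds, in those of the
polynomial with `-X` for `X`. Polynomials are pairs of lists because the kernel has fast arithmetic
for natural numbers only. -/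
def variations (e : Bool) : List ℕ → List ℕ → ℕ
  | a :: p, b :: q =>
    bif Nat.beq a b then variations e p q else varFrom e p q (xor (Nat.blt b a) e)
  | _, _ => 0

/-- The sum of two pairs. -/
def addPair (x y : ℕ × ℕ) : ℕ × ℕ := (Nat.add x.1 y.1, Nat.add x.2 y.2)

/-- Bounds for `2 ^ d` times the sum of `max 0 (min r 1)` over the six roots `r` of `p - q`. The
lists `p₁` and `q₁` have the roots `r - 1`; at least `lo` roots are at least `1`, and at most `up`
roots are positive. The interval `[0, 1]` is bisected until `lo` and `up` agree or the depth `d`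
is used up; Descartes' rule bounds the numbers of roots beyond the midpoint. -/
def clampBounds : ℕ → List ℕ → List ℕ → List ℕ → List ℕ → ℕ → ℕ → ℕ × ℕ
  | 0, _, _, _, _, lo, up => (lo, up)
  | d + 1, p, q, p₁, q₁, lo, up =>
    bif Nat.beq lo up then (Nat.shiftLeft lo (Nat.succ d), Nat.shiftLeft up (Nat.succ d))
    else
      force (variations false (shift (scale p 0)) (shift (scale q 0))) fun u =>
      force (Nat.sub 6 (variations true (shift (scale p 0)) (shift (scale q 0)))) fun l =>
      addPair
        (clampBounds d (scale p 0) (scale q 0) (shift (scale p 0)) (shift (scale q 0)) l up)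
        (clampBounds d (shift (scale p 0)) (shift (scale q 0)) (scale p₁ 0) (scale q₁ 0) lo u)

/-- The positive part of `720` times the monic polynomial whose roots are `1 / 8` of the six numbers
with power sums `0, p₂, …, p₆`, multiplied by `8 ^ 6`. The factor `720` clears the denominators in
Newton's identities, and the roots get into `[-1, 1]` as no eigenvalue exceeds `6` in absolute
value. -/
def posPart (p₂ p₃ p₄ : ℕ) : List ℕ :=
  [720 * 8 ^ 6, 0, 0, 0, 90 * p₂ ^ 2 * 8 ^ 2, 120 * p₂ * p₃ * 8, 90 * p₂ * p₄ + 40 * p₃ ^ 2]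

/-- The negative part of the polynomial described at `posPart`. -/
def negPart (p₂ p₃ p₄ p₅ p₆ : ℕ) : List ℕ :=
  [0, 0, 360 * p₂ * 8 ^ 4, 240 * p₃ * 8 ^ 3, 180 * p₄ * 8 ^ 2, 144 * p₅ * 8,
    15 * p₂ ^ 3 + 120 * p₆]

/-- Bounds for `2 ^ 22` times the sum of the absolute values of six numbers with power sums `0,
p₂, …, p₆`. Twenty-six bisections suffice: among the local energies of the graphs on six vertices
the smallest nonzero difference is about `6.7 * 10 ^ (-6)`. -/
def sumBounds (p₂ p₃ p₄ p₅ p₆ : ℕ) : ℕ × ℕ :=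
  let p := posPart p₂ p₃ p₄
  let q := negPart p₂ p₃ p₄ p₅ p₆
  clampBounds 26 p q (shift p) (shift q) (Nat.sub 6 (variations true (shift p) (shift q)))
    (variations false p q)

/-! ### Bounds for local energies, as computations -/

/-- The sum of `f 0, …, f 5`. -/
def sum6 (f : ℕ → ℕ) : ℕ :=
  Nat.add (Nat.add (Nat.add (f 0) (f 1)) (Nat.add (f 2) (f 3))) (Nat.add (f 4) (f 5))

/-- The entries of the adjacency matrix `A` of the graph with code `m`. -/
def entry (m i j : ℕ) : ℕ := bif adj 6 m i j then 1 else 0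

/-- The entries of `A ^ 2`. -/
def entry₂ (m i j : ℕ) : ℕ := sum6 fun k => Nat.mul (entry m i k) (entry m k j)

/-- The entries of `A ^ 3`. -/
def entry₃ (m i j : ℕ) : ℕ := sum6 fun k => Nat.mul (entry m i k) (entry₂ m k j)

/-- The trace of the product of two matrices of size six. -/
def pairing (f g : ℕ → ℕ → ℕ) : ℕ := sum6 fun i => sum6 fun j => Nat.mul (f i j) (g j i)

/-- The value of `F` at the numbers of closed walks of lengths `2, …, 6` in the graph with code `m`.
These are the power sums of its eigenvalues. -/
def withWalks {α : Type} (m : ℕ) (F : ℕ → ℕ → ℕ → ℕ → ℕ → α) : α :=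
  force (pairing (entry m) (entry m)) fun p₂ =>
  force (pairing (entry m) (entry₂ m)) fun p₃ =>
  force (pairing (entry₂ m) (entry₂ m)) fun p₄ =>
  force (pairing (entry₂ m) (entry₃ m)) fun p₅ =>
  force (pairing (entry₃ m) (entry₃ m)) fun p₆ => F p₂ p₃ p₄ p₅ p₆

/-- Bounds for `2 ^ 22` times the energy of the graph with code `m`. -/
def energyBounds (m : ℕ) : ℕ × ℕ := withWalks m sumBounds

/-- The code of the complete graph on the vertices other than `v`. The bitwise conjunction with it
removes the edges at `v`. -/
def keep (v : ℕ) : ℕ := code 6 fun i j => !(Nat.beq i v || Nat.beq j v)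

/-- The local energy of the graph with code `m` is a difference `x - y`, with six times the energy
for `x` and the sum of the energies of the vertex-deleted subgraphs for `y`. These are lower and
upper bounds for `2 ^ 22 * x`, followed by those for `2 ^ 22 * y`. -/
def localBounds (m : ℕ) : ℕ × ℕ × ℕ × ℕ :=
  let x := energyBounds m
  let y v := force (Nat.land m (keep v)) energyBounds
  force (Nat.mul 6 x.1) fun a =>
  force (Nat.mul 6 x.2) fun b =>
  force (sum6 fun v => (y v).1) fun c =>
  force (sum6 fun v => (y v).2) fun d => (a, b, c, d)

/-- The codes of `K₆`, `K₄ ∪ K₂`, `K₃ ∪ K₃` and `K₂ ∪ K₂ ∪ K₂`. -/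
def codes₁ : List ℕ := [32767, 5872, 5905, 656]

/-- The codes of `K₅ ∪ K₁`, `K₃ ∪ K₂ ∪ K₁` and `C₅ ∪ K₁`. -/
def codes₂ : List ℕ := [5871, 616, 684]

/-- The codes of `K₄ ∪ K₁ ∪ K₁` and `K₂ ∪ K₂ ∪ K₁ ∪ K₁`. -/
def codes₃ : List ℕ := [615, 36]

/-- Whether `m` and `n` are on the same one of the three lists. -/
def sameClass (m n : ℕ) : Bool :=
  [codes₁, codes₂, codes₃].any fun l => l.contains m && l.contains n

/-- Whether the local energy with bounds `x` is certainly smaller than the one with bounds `y`. -/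
def below (x y : ℕ × ℕ × ℕ × ℕ) : Bool :=
  Nat.blt (Nat.add x.2.1 y.2.2.2) (Nat.add y.1 x.2.2.1)

/-- Whether the bounds tell the local energies of the graphs with codes `m` and `n` apart, or both
codes are on the same list. -/
def separated (m n : ℕ) : Bool :=
  below (localBounds m) (localBounds n) || below (localBounds n) (localBounds m) ||
    sameClass m n

/-- Whether `r a b` holds whenever `a` precedes `b` in the list. -/
def allPairs (r : ℕ → ℕ → Bool) : List ℕ → Bool
  | [] => true
  | a :: l => l.all (r a) && allPairs r l

/-- Whether the bounds for the local energy of the graph with code `m` leave the value `v` only. -/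
def exactly (v m : ℕ) : Bool :=
  let b := localBounds m
  Nat.beq b.1 b.2.1 && Nat.beq b.2.2.1 b.2.2.2 && Nat.beq b.1 (Nat.add b.2.2.1 (v * 2 ^ 22))

/-- The numbers of closed walks of lengths `2, …, 6` in the graph with code `m`. -/
def walks (m : ℕ) : List ℕ := withWalks m fun p₂ p₃ p₄ p₅ p₆ => [p₂, p₃, p₄, p₅, p₆]

/-! ### Every graph on six vertices has a code in `reps 6` -/

theorem force_eq {α : Type} (n : ℕ) (f : ℕ → α) : force n f = f n := by
  cases n <;> rfl

theorem val_append (l l' : List Bool) : val (l ++ l') = val l * 2 ^ l'.length + val l' := by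
  induction l' using List.reverseRecOn with
  | nil => simp [val]
  | append_singleton l' b ih =>
    rw [← List.append_assoc]
    simp only [val, List.foldl_append, List.foldl_cons, List.foldl_nil, List.length_append,
      List.length_cons, List.length_nil] at ih ⊢
    rw [ih]
    ring

theorem val_cons (b : Bool) (l : List Bool) : val (b :: l) = 2 ^ l.length * b.toNat + val l := by
  have := val_append [b] l
  simp only [List.singleton_append] at this
  rw [this, mul_comm]
  simp [val]

theorem val_lt (l : List Bool) : val l < 2 ^ l.length := by
  induction l with
  | nil => simp [val]
  | cons b l ih =>
    rw [val_cons, List.length_cons, pow_succ]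
    cases b <;> simp <;> omega

theorem testBit_val (l : List Bool) (k : ℕ) (hk : k < l.length) :
    (val l).testBit (l.length - 1 - k) = l[k] := by
  induction l generalizing k with
  | nil => simp at hk
  | cons b l ih =>
    rw [val_cons, Nat.testBit_two_pow_mul_add _ (val_lt l)]
    cases k with
    | zero => cases b <;> simp
    | succ k =>
      have hk' : k < l.length := by simpa using hk
      rw [if_pos (by simp; omega)]
      have : (b :: l).length - 1 - (k + 1) = l.length - 1 - k := by simp; omega
      rw [this, ih k hk']
      simp

theorem digit_eq_testBit (m i : ℕ) : digit m i = m.testBit i := by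
  rw [Bool.eq_iff_iff, digit, Nat.beq_eq, Nat.testBit, bne_iff_ne]
  change 1 = 1 &&& (m >>> i) ↔ 1 &&& (m >>> i) ≠ 0
  rw [Nat.one_and_eq_mod_two]
  omega

theorem blt_eq_false {i j : ℕ} (h : j ≤ i) : Nat.blt i j = false := by
  rw [← Bool.not_eq_true, Nat.blt_eq]
  omega

theorem tri_succ (n : ℕ) : tri (n + 1) = tri n + n := Nat.triangle_succ n

theorem length_pairs (n : ℕ) : (pairs n).length = tri n := by
  induction n with
  | zero => rfl
  | succ n ih => simp [pairs, ih, tri_succ]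

theorem getElem?_pairs {n i j : ℕ} (hij : i < j) (hj : j < n) :
    (pairs n)[tri j + i]? = some (i, j) := by
  induction n with
  | zero => omega
  | succ n ih =>
    rcases Nat.lt_succ_iff_lt_or_eq.1 hj with h | rfl
    · have := ih h
      rw [pairs, List.getElem?_append_left, this]
      exact (List.getElem?_eq_some_iff.1 this).1
    · rw [pairs, List.getElem?_append_right (by rw [length_pairs]; omega), length_pairs]
      simp [hij]

theorem mem_pairs {n : ℕ} {p : ℕ × ℕ} (h : p ∈ pairs n) : p.1 < p.2 ∧ p.2 < n := by
  induction n with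
  | zero => simp [pairs] at h
  | succ n ih =>
    rcases List.mem_append.1 h with h | h
    · have := ih h
      omega
    · obtain ⟨i, hi, rfl⟩ := List.mem_map.1 h
      simpa using hi

theorem digit_code {n i j : ℕ} (f : ℕ → ℕ → Bool) (hij : i < j) (hj : j < n) :
    digit (code n f) (Nat.sub (Nat.pred (tri n)) (Nat.add (tri j) i)) = f i j := by
  have h := getElem?_pairs hij hj
  obtain ⟨hlt, heq⟩ := List.getElem?_eq_some_iff.1 h
  have := testBit_val ((pairs n).map fun p => f p.1 p.2) (tri j + i) (by simpa using hlt)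
  rw [List.getElem_map, heq, List.length_map, length_pairs] at this
  rw [digit_eq_testBit]
  exact this

theorem adj_code {n i j : ℕ} {f : ℕ → ℕ → Bool} (hs : ∀ i j, f i j = f j i)
    (hf : ∀ i, f i i = false) (hi : i < n) (hj : j < n) : adj n (code n f) i j = f i j := by
  unfold adj
  rcases lt_trichotomy i j with h | h | h
  · rw [show Nat.blt i j = true from by simpa [Nat.blt_eq] using h, cond_true, digit_code f h hj]
  · subst h
    simp [blt_eq_false, hf]
  · rw [blt_eq_false h.le, show Nat.blt j i = true from by simpa [Nat.blt_eq] using h, cond_false,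
      cond_true, digit_code f h hi, hs]

/-- The code on `n + 1` vertices begins with the code on the first `n` vertices. Hence minimality
passes to the first `n` vertices, and minimal codes can be found one vertex at a time. -/
theorem code_succ (n : ℕ) (f : ℕ → ℕ → Bool) :
    code (n + 1) f = code n f * 2 ^ n + val ((List.range n).map fun i => f i n) := by
  simp only [code, pairs, List.map_append, val_append, List.length_map, List.map_map,
    List.length_range]
  rfl

theorem lexLE_of_val_le (f g : ℕ × ℕ → Bool) (l : List (ℕ × ℕ))
    (h : val (l.map f) ≤ val (l.map g)) : lexLE f g l = true := by
  induction l with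
  | nil => rfl
  | cons p l ih =>
    simp only [List.map_cons, val_cons, List.length_map] at h
    have h1 := val_lt (l.map f)
    have h2 := val_lt (l.map g)
    rw [List.length_map] at h1 h2
    unfold lexLE
    cases hf : f p <;> cases hg : g p <;> simp only [hf, hg, Bool.toNat_true, Bool.toNat_false,
      cond_true, cond_false] at h ⊢
    · exact ih (by omega)
    · omega
    · exact ih (by omega)

theorem lexLE_congr {f f' g g' : ℕ × ℕ → Bool} {l : List (ℕ × ℕ)} (hf : ∀ p ∈ l, f p = f' p)
    (hg : ∀ p ∈ l, g p = g' p) : lexLE f g l = lexLE f' g' l := by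
  induction l with
  | nil => rfl
  | cons p l ih =>
    simp only [List.mem_cons, forall_eq_or_imp] at hf hg
    simp only [lexLE, hf.1, hg.1, ih hf.2 hg.2]

/-- `act w` as a permutation. -/
def actPerm (w : List (ℕ × ℕ)) : Equiv.Perm ℕ := (w.map fun p => Equiv.swap p.1 p.2).prod

theorem act_eq (w : List (ℕ × ℕ)) (k : ℕ) : act w k = actPerm w k := by
  induction w with
  | nil => rfl
  | cons p w ih =>
    have h1 : act (p :: w) k = bif Nat.beq (act w k) p.1 then p.2
      else bif Nat.beq (act w k) p.2 then p.1 else act w k := rfl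
    have h2 : actPerm (p :: w) k = Equiv.swap p.1 p.2 (actPerm w k) := by
      simp [actPerm, Equiv.Perm.mul_apply]
    rw [h1, h2, ih, Equiv.swap_apply_def]
    have hb : ∀ a b : ℕ, Nat.beq a b = decide (a = b) := fun a b => by
      rw [Bool.eq_iff_iff, Nat.beq_eq, decide_eq_true_iff]
    simp only [hb, Bool.cond_decide]

theorem actPerm_apply_of_le {n : ℕ} {w : List (ℕ × ℕ)} (hw : ∀ p ∈ w, p.1 < n ∧ p.2 < n) {k : ℕ}
    (hk : n ≤ k) : actPerm w k = k := by
  induction w with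
  | nil => rfl
  | cons p w ih =>
    have h2 : actPerm (p :: w) k = Equiv.swap p.1 p.2 (actPerm w k) := by
      simp [actPerm, Equiv.Perm.mul_apply]
    simp only [List.mem_cons, forall_eq_or_imp] at hw
    rw [h2, ih hw.2, Equiv.swap_apply_of_ne_of_ne] <;> omega

theorem apply_lt_of_fix {n : ℕ} {σ : Equiv.Perm ℕ} (hσ : ∀ k, n ≤ k → σ k = k) {i : ℕ}
    (hi : i < n) : σ i < n := by
  by_contra h
  have := σ.injective (hσ (σ i) (not_lt.1 h))
  omega

/-- The code of `f` on `0, …, n - 1` cannot be decreased by relabelling. -/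
def IsMinimal (n : ℕ) (f : ℕ → ℕ → Bool) : Prop :=
  ∀ σ : Equiv.Perm ℕ, (∀ k, n ≤ k → σ k = k) → code n f ≤ code n fun i j => f (σ i) (σ j)

theorem exists_isMinimal (n : ℕ) (f : ℕ → ℕ → Bool) :
    ∃ σ : Equiv.Perm ℕ, (∀ k, n ≤ k → σ k = k) ∧ IsMinimal n fun i j => f (σ i) (σ j) := by
  classical
  have hex : ∃ c, ∃ σ : Equiv.Perm ℕ, (∀ k, n ≤ k → σ k = k) ∧
      code n (fun i j => f (σ i) (σ j)) = c := ⟨_, 1, fun _ _ => rfl, rfl⟩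
  obtain ⟨σ, hσ, h⟩ := Nat.find_spec hex
  refine ⟨σ, hσ, fun τ hτ => ?_⟩
  rw [h]
  exact Nat.find_min' hex ⟨σ * τ, fun k hk => by
    rw [Equiv.Perm.mul_apply, hτ k hk, hσ k hk], rfl⟩

/-- A permutation of `0, …, n - 1` that decreases the leading part of the code decreases the
code. -/
theorem IsMinimal.of_succ {n : ℕ} {f : ℕ → ℕ → Bool} (h : IsMinimal (n + 1) f) :
    IsMinimal n f := by
  intro σ hσ
  have h1 := h σ fun k hk => hσ k (by omega)
  rw [code_succ, code_succ] at h1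
  have h2 : ∀ g : ℕ → Bool, val ((List.range n).map g) < 2 ^ n := fun g => by
    simpa using val_lt ((List.range n).map g)
  have h3 := Nat.div_le_div_right (c := 2 ^ n) h1
  rwa [mul_comm, Nat.mul_add_div (by positivity), Nat.div_eq_of_lt (h2 _), mul_comm,
    Nat.mul_add_div (by positivity), Nat.div_eq_of_lt (h2 _), add_zero, add_zero] at h3

theorem IsMinimal.isReduced {n : ℕ} {f : ℕ → ℕ → Bool} (hs : ∀ i j, f i j = f j i)
    (hf : ∀ i, f i i = false) (h : IsMinimal n f) : isReduced n (code n f) = true := by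
  unfold SixVertex.isReduced
  rw [List.all_eq_true]
  intro w hw
  rw [List.mem_filter, List.all_eq_true] at hw
  have hw' : ∀ p ∈ w, p.1 < n ∧ p.2 < n := fun p hp => by
    simpa [Nat.blt_eq] using hw.2 p hp
  have hfix : ∀ k, n ≤ k → actPerm w k = k := fun k hk => actPerm_apply_of_le hw' hk
  rw [lexLE_congr (f' := fun p => f p.1 p.2)
    (g' := fun p => f (actPerm w p.1) (actPerm w p.2))]
  · exact lexLE_of_val_le _ _ _ (h (actPerm w) hfix)
  · intro p hp
    have := mem_pairs hp
    exact adj_code hs hf (by omega) (by omega)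
  · intro p hp
    have := mem_pairs hp
    simp only [act_eq]
    exact adj_code hs hf (apply_lt_of_fix hfix (by omega)) (apply_lt_of_fix hfix (by omega))

theorem mem_foldr_of {P : ℕ → Bool} {g : ℕ → ℕ} {l : List ℕ} {x : ℕ} (hx : x ∈ l)
    (hP : P (g x) = true) :
    g x ∈ l.foldr (fun x l => force (g x) fun c => bif P c then c :: l else l) [] := by
  induction l with
  | nil => simp at hx
  | cons y l ih =>
    rw [List.foldr_cons, force_eq]
    rcases List.mem_cons.1 hx with rfl | hx
    · simp [hP]
    · cases P (g y)
      · exact ih hx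
      · exact List.mem_cons_of_mem _ (ih hx)

theorem IsMinimal.code_mem_reps {n : ℕ} {f : ℕ → ℕ → Bool} (hs : ∀ i j, f i j = f j i)
    (hf : ∀ i, f i i = false) (h : IsMinimal n f) : code n f ∈ reps n := by
  induction n with
  | zero => simp [reps, code, pairs, val]
  | succ n ih =>
    have hred := h.isReduced hs hf
    rw [code_succ] at hred ⊢
    refine List.mem_flatMap.2 ⟨code n f, ih h.of_succ, ?_⟩
    refine mem_foldr_of (P := SixVertex.isReduced (n + 1))
      (g := fun x => Nat.add (Nat.mul (code n f) (2 ^ n)) x) (List.mem_range.2 ?_) hred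
    simpa using val_lt ((List.range n).map fun i => f i n)

theorem adj_comm (n m i j : ℕ) : adj n m i j = adj n m j i := by
  unfold adj
  rcases lt_trichotomy i j with h | h | h
  · have h1 : Nat.blt i j = true := by simpa [Nat.blt_eq] using h
    have h2 := blt_eq_false h.le
    simp [h1, h2]
  · rw [h]
  · have h1 : Nat.blt j i = true := by simpa [Nat.blt_eq] using h
    have h2 := blt_eq_false h.le
    simp [h1, h2]

theorem adj_self (n m i : ℕ) : adj n m i i = false := by
  simp [adj, blt_eq_false]

/-- The graph on six vertices with code `m`. -/
def ofCode (m : ℕ) : FinGraph where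
  V := Fin 6
  fintypeV := inferInstance
  graph :=
    { Adj := fun i j => adj 6 m i j = true
      symm := ⟨fun i j h => by rwa [adj_comm]⟩
      loopless := ⟨fun i h => by simp [adj_self] at h⟩ }

/-- Every graph on six vertices can be relabelled so that its code is minimal, and `reps` keeps all
minimal codes. -/
theorem exists_iso_ofCode (G : FinGraph) (hG : G.order = 6) :
    ∃ m ∈ reps 6, G.Iso (ofCode m) := by
  classical
  let e : G.V ≃ Fin 6 := Fintype.equivFinOfCardEq hG
  let f : ℕ → ℕ → Bool := fun i j =>
    if h : i < 6 ∧ j < 6 then decide (G.graph.Adj (e.symm ⟨i, h.1⟩) (e.symm ⟨j, h.2⟩)) else false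
  have hs : ∀ i j, f i j = f j i := fun i j => by
    by_cases h : i < 6 ∧ j < 6
    · simp only [f, h, and_self, dite_true, G.graph.adj_comm]
    · simp only [f, h, dite_false, mt And.symm h]
  have hf : ∀ i, f i i = false := fun i => by simp [f]
  obtain ⟨σ, hσ, hmin⟩ := exists_isMinimal 6 f
  have hlt : ∀ i : Fin 6, σ i < 6 := fun i => apply_lt_of_fix hσ i.2
  let τ : Fin 6 ≃ Fin 6 := Equiv.ofBijective (fun i => ⟨σ i, hlt i⟩) <|
    Finite.injective_iff_bijective.1 fun i j h => Fin.ext (σ.injective (Fin.mk.inj_iff.1 h))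
  refine ⟨_, hmin.code_mem_reps (fun _ _ => hs _ _) (fun _ => hf _), ⟨SimpleGraph.Iso.symm
    { toEquiv := τ.trans e.symm, map_rel_iff' := ?_ }⟩⟩
  intro (i : Fin 6) (j : Fin 6)
  change _ ↔ adj 6 _ i j = true
  rw [adj_code (fun _ _ => hs _ _) (fun _ => hf _) i.2 j.2]
  simp only [f, hlt i, hlt j, and_self, dite_true, decide_eq_true_eq]
  rfl

end SixVertex

namespace SixVertex
open Polynomial

/-! ### Counting the roots of a real-rooted polynomial -/

/-- The polynomial with coefficient list `l`, highest coefficient first. -/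
noncomputable def toPoly : List ℕ → ℝ[X]
  | [] => 0
  | a :: l => Polynomial.C (a : ℝ) * X ^ l.length + toPoly l

theorem toPoly_append_singleton (l : List ℕ) (a : ℕ) :
    toPoly (l ++ [a]) = toPoly l * X + Polynomial.C (a : ℝ) := by
  induction l with
  | nil => simp [toPoly]
  | cons b l ih =>
    simp only [List.cons_append, toPoly, ih, List.length_append, List.length_cons, List.length_nil]
    ring

theorem degree_toPoly_lt (l : List ℕ) : (toPoly l).degree < l.length := by
  induction l with
  | nil => simp [toPoly]
  | cons a l ih =>
    refine lt_of_le_of_lt (degree_add_le _ _)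
      (max_lt ?_ (ih.trans (by simp; exact_mod_cast Nat.lt_succ_self _)))
    exact lt_of_le_of_lt (degree_C_mul_X_pow_le _ _) (by simp; exact_mod_cast Nat.lt_succ_self _)

theorem length_mulAdd (k : ℕ) (l : List ℕ) (x : ℕ) : (mulAdd k l x).length = l.length + 1 := by
  induction l generalizing x with
  | nil => rfl
  | cons a l ih => simp [mulAdd, ih]

theorem toPoly_mulAdd (k : ℕ) (l : List ℕ) (x : ℕ) :
    toPoly (mulAdd k l x) =
      Polynomial.C (x : ℝ) * X ^ l.length + (X + 1) * toPoly l + Polynomial.C (k : ℝ) := by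
  induction l generalizing x with
  | nil => simp [toPoly, mulAdd]
  | cons a l ih =>
    simp only [mulAdd, toPoly, ih, length_mulAdd, Nat.add_eq, Nat.cast_add, map_add,
      List.length_cons]
    ring

theorem shift_append_singleton (l : List ℕ) (a : ℕ) : shift (l ++ [a]) = mulAdd a (shift l) 0 := by
  simp [shift]

theorem length_shift (l : List ℕ) : (shift l).length = l.length := by
  induction l using List.reverseRecOn with
  | nil => rfl
  | append_singleton l a ih => simp [shift_append_singleton, length_mulAdd, ih]

theorem toPoly_shift (l : List ℕ) : toPoly (shift l) = (toPoly l).comp (X + 1) := by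
  induction l using List.reverseRecOn with
  | nil => simp [toPoly, shift]
  | append_singleton l a ih =>
    rw [shift_append_singleton, toPoly_mulAdd, ih, toPoly_append_singleton]
    simp only [Nat.cast_zero, map_zero, zero_mul, zero_add, add_comp, mul_comp, X_comp, C_comp]
    ring

theorem length_scale (l : List ℕ) (k : ℕ) : (scale l k).length = l.length := by
  induction l generalizing k with
  | nil => rfl
  | cons a l ih => simp [scale, ih]

/-- The list `scale l 0` represents `2 ^ n * P (X / 2)`, where `P` has the coefficients
`l` and `n + 1` is their number. -/
theorem toPoly_scale (l : List ℕ) (k : ℕ) :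
    Polynomial.C 2 * (toPoly (scale l k)).comp (Polynomial.C 2 * X) =
      Polynomial.C (2 ^ (k + l.length)) * toPoly l := by
  induction l generalizing k with
  | nil => simp [toPoly, scale]
  | cons a l ih =>
    have h : ((Nat.shiftLeft a k : ℕ) : ℝ) = a * 2 ^ k := by
      rw [show Nat.shiftLeft a k = a * 2 ^ k from Nat.shiftLeft_eq a k]
      push_cast
      rfl
    simp only [scale, toPoly, length_scale, add_comp, mul_add, ih, h, mul_comp, C_comp, pow_comp,
      X_comp, List.length_cons, mul_pow, map_mul, map_pow, Nat.succ_eq_add_one]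
    ring

theorem comp_add_of_cons (p q : List ℕ) (h : p.length = q.length) (a b : ℕ) (ε : ℝ) :
    (toPoly (a :: p) - toPoly (b :: q)).comp (Polynomial.C ε * X) =
      Polynomial.C (((a : ℝ) - b) * ε ^ p.length) * X ^ p.length +
        (toPoly p - toPoly q).comp (Polynomial.C ε * X) := by
  simp only [toPoly, sub_comp, add_comp, mul_comp, C_comp, pow_comp, X_comp, ← h, map_mul, map_sub,
    map_pow, mul_pow]
  ring

theorem degree_comp_lt (p q : List ℕ) (h : p.length = q.length) (ε : ℝ) :
    ((toPoly p - toPoly q).comp (Polynomial.C ε * X)).degree < p.length := by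
  have h1 : (toPoly p - toPoly q).degree < p.length :=
    lt_of_le_of_lt (degree_sub_le _ _) (max_lt (degree_toPoly_lt p) (h ▸ degree_toPoly_lt q))
  rw [degree_lt_iff_coeff_zero] at h1 ⊢
  intro m hm
  rw [comp_C_mul_X_coeff, h1 m hm, zero_mul]

theorem leadingCoeff_add {c : ℝ} (hc : c ≠ 0) {k : ℕ} {R : ℝ[X]} (hR : R.degree < k) :
    (Polynomial.C c * X ^ k + R).leadingCoeff = c := by
  rw [add_comm, leadingCoeff_add_of_degree_lt (by rwa [degree_C_mul_X_pow k hc]),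
    leadingCoeff_C_mul_X_pow]

/-- A new leading term adds a sign change if the next nonzero coefficient has the opposite
sign. -/
theorem signVariations_add {c : ℝ} (hc : c ≠ 0) {k : ℕ} {R : ℝ[X]} (hR : R.degree < k) :
    (Polynomial.C c * X ^ k + R).signVariations =
      R.signVariations + if SignType.sign c = -SignType.sign R.leadingCoeff then 1 else 0 := by
  have hdeg : R.degree < (Polynomial.C c * X ^ k).degree := by rwa [degree_C_mul_X_pow k hc]
  have hlead := leadingCoeff_add hc hR
  have hne : Polynomial.C c * X ^ k + R ≠ 0 := by
    rw [← leadingCoeff_ne_zero, hlead]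
    exact hc
  rw [signVariations_eq_eraseLead_add_ite hne, hlead, eraseLead_add_of_degree_lt_left hdeg,
    eraseLead_C_mul_X_pow, zero_add]

/-- The sign of the factor `±1` by which the variable is multiplied. -/
def altSign (e : Bool) : SignType := if e then -1 else 1

/-- The number `varFrom e p q s` is the number of sign changes in the remaining polynomial, plus one
if its leading coefficient has the sign opposite to that of the earlier coefficient. -/
theorem varFrom_eq (e : Bool) (p q : List ℕ) (h : p.length = q.length) (s : Bool) :
    varFrom e p q s =
      ((toPoly p - toPoly q).comp (Polynomial.C ((altSign e : SignType) : ℝ) * X)).signVariations +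
      if SignType.sign ((toPoly p - toPoly q).comp
          (Polynomial.C ((altSign e : SignType) : ℝ) * X)).leadingCoeff =
        -((if s then 1 else -1) * altSign e ^ (p.length + 1)) then 1 else 0 := by
  induction p generalizing q s with
  | nil =>
    obtain rfl : q = [] := List.length_eq_zero_iff.1 h.symm
    have h1 : ¬ (0 : SignType) = -((if s then 1 else -1) * altSign e ^ (0 + 1)) := by
      cases e <;> cases s <;> decide
    simp only [varFrom, sub_self, zero_comp, signVariations_zero, leadingCoeff_zero, sign_zero,
      List.length_nil, if_neg h1]
  | cons a p ih =>
    obtain _ | ⟨b, q⟩ := q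
    · simp at h
    have h' : p.length = q.length := by simpa using h
    have hdeg := degree_comp_lt p q h' (altSign e : SignType)
    have hsucc : altSign e ^ (p.length + 1) = altSign e * altSign e ^ p.length := pow_succ' _ _
    have hpow : altSign e ^ p.length = 1 ∨ altSign e ^ p.length = -1 := by
      cases e
      · exact Or.inl (one_pow _)
      · exact neg_one_pow_eq_or _ _
    rw [comp_add_of_cons p q h', varFrom]
    simp only [ih q h', List.length_cons, hsucc, pow_succ' (altSign e) (p.length + 1)]
    have hε : SignType.sign ((((altSign e : SignType) : ℝ)) ^ p.length) =
        altSign e ^ p.length := by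
      rw [sign_pow]
      cases e <;> simp [altSign]
    set R := (toPoly p - toPoly q).comp (Polynomial.C ((altSign e : SignType) : ℝ) * X)
    set ρ : ℝ := ((altSign e : SignType) : ℝ) ^ p.length
    generalize altSign e ^ p.length = η at hpow hε
    have hρ : ρ ≠ 0 := by
      rw [← sign_ne_zero, hε]
      rcases hpow with rfl | rfl <;> decide
    rcases lt_trichotomy a b with hab | hab | hab
    · have hc : (a : ℝ) - b < 0 := by rw [sub_neg]; exact_mod_cast hab
      have h1 : Nat.beq a b = false := by rw [← Bool.not_eq_true, Nat.beq_eq]; omega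
      rw [signVariations_add (mul_ne_zero hc.ne hρ) hdeg, leadingCoeff_add (mul_ne_zero hc.ne hρ)
        hdeg, sign_mul, hε, sign_neg hc, h1, blt_eq_false hab.le]
      generalize SignType.sign R.leadingCoeff = t
      rcases hpow with rfl | rfl <;> cases e <;> cases s <;> cases t <;>
        simp [altSign]
    · have h1 : Nat.beq a b = true := by rw [Nat.beq_eq]; omega
      rw [h1, hab, sub_self, zero_mul, C_0, zero_mul, zero_add]
      generalize SignType.sign R.leadingCoeff = t
      rcases hpow with rfl | rfl <;> cases e <;> cases s <;> cases t <;>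
        simp [altSign]
    · have hc : 0 < (a : ℝ) - b := by rw [sub_pos]; exact_mod_cast hab
      have h1 : Nat.beq a b = false := by rw [← Bool.not_eq_true, Nat.beq_eq]; omega
      have h2 : Nat.blt b a = true := by rwa [Nat.blt_eq]
      rw [signVariations_add (mul_ne_zero hc.ne' hρ) hdeg, leadingCoeff_add
        (mul_ne_zero hc.ne' hρ) hdeg, sign_mul, hε, sign_pos hc, h1, h2]
      generalize SignType.sign R.leadingCoeff = t
      rcases hpow with rfl | rfl <;> cases e <;> cases s <;> cases t <;>
        simp [altSign]

theorem variations_eq (e : Bool) (p q : List ℕ) (h : p.length = q.length) :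
    variations e p q =
      ((toPoly p - toPoly q).comp
        (Polynomial.C ((altSign e : SignType) : ℝ) * X)).signVariations := by
  induction p generalizing q with
  | nil =>
    obtain rfl : q = [] := List.length_eq_zero_iff.1 h.symm
    simp [variations]
  | cons a p ih =>
    obtain _ | ⟨b, q⟩ := q
    · simp at h
    have h' : p.length = q.length := by simpa using h
    by_cases hab : a = b
    · have h1 : Nat.beq a b = true := by rw [Nat.beq_eq]; omega
      rw [variations, h1, cond_true, ih q h', comp_add_of_cons p q h', hab, sub_self, zero_mul,
        C_0, zero_mul, zero_add]
    · have h1 : Nat.beq a b = false := by rw [← Bool.not_eq_true, Nat.beq_eq]; omega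
      -- start as if an earlier coefficient had the sign of the first one
      have h2 : variations e (a :: p) (b :: q) = varFrom e (a :: p) (b :: q) (Nat.blt b a) := by
        rw [variations, varFrom, h1]
        cases Nat.blt b a <;> simp
      have hc : (a : ℝ) - b ≠ 0 := sub_ne_zero.2 (by exact_mod_cast hab)
      have hε : (((altSign e : SignType) : ℝ)) ≠ 0 := by cases e <;> simp [altSign]
      have hε' : SignType.sign (((altSign e : SignType) : ℝ)) = altSign e := by
        cases e <;> simp [altSign]
      have hs : SignType.sign ((a : ℝ) - b) = if Nat.blt b a then 1 else -1 := by
        rcases lt_or_gt_of_ne hab with h | h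
        · rw [sign_neg (by rw [sub_neg]; exact_mod_cast h), blt_eq_false h.le]
          rfl
        · rw [sign_pos (by rw [sub_pos]; exact_mod_cast h),
            show Nat.blt b a = true by rwa [Nat.blt_eq]]
          rfl
      have hdeg := degree_comp_lt p q h' (altSign e : SignType)
      rw [h2, varFrom_eq e _ _ h, if_neg, add_zero]
      rw [comp_add_of_cons p q h', leadingCoeff_add (mul_ne_zero hc (pow_ne_zero _ hε)) hdeg,
        sign_mul, sign_pow, hε', hs, List.length_cons, pow_succ', pow_succ']
      have hpow : altSign e ^ p.length = 1 ∨ altSign e ^ p.length = -1 := by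
        cases e
        · exact Or.inl (one_pow _)
        · exact neg_one_pow_eq_or _ _
      generalize altSign e ^ p.length = η at hpow
      rcases hpow with rfl | rfl <;> cases e <;> cases Nat.blt b a <;> decide

/-- The difference of the polynomials with coefficients `p` and `q` is a nonzero multiple of the
monic polynomial with root multiset `s`. -/
def HasRoots (p q : List ℕ) (s : Multiset ℝ) : Prop :=
  p.length = q.length ∧
    ∃ c : ℝ, c ≠ 0 ∧ toPoly p - toPoly q = Polynomial.C c * (s.map fun r => X - Polynomial.C r).prod

/-- If `P (a * X + b)` is a multiple of `Q`, then the roots of `P` are the numbers `a * r + b` for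
the roots `r` of `Q`. -/
theorem eq_prod_of_comp {P Q : ℝ[X]} {s : Multiset ℝ} {a b c k : ℝ} (ha : a ≠ 0) (hk : k ≠ 0)
    (hc : c ≠ 0) (hQ : Q = Polynomial.C c * (s.map fun r => X - Polynomial.C r).prod)
    (h : P.comp (Polynomial.C a * X + Polynomial.C b) = Polynomial.C k * Q) :
    ∃ c' : ℝ, c' ≠ 0 ∧
      P = Polynomial.C c' * ((s.map fun r => a * r + b).map fun r => X - Polynomial.C r).prod := by
  have h1 : P = (P.comp (Polynomial.C a * X + Polynomial.C b)).comp
      (Polynomial.C a⁻¹ * (X - Polynomial.C b)) := by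
    rw [comp_assoc]
    simp only [add_comp, mul_comp, C_comp, X_comp, ← mul_assoc, ← C_mul, mul_inv_cancel₀ ha]
    simp
  refine ⟨k * c * a⁻¹ ^ s.card, by positivity, ?_⟩
  rw [h1, h, hQ]
  simp only [mul_comp, C_comp, multiset_prod_comp, Multiset.map_map]
  have h2 : ∀ r : ℝ, (X - Polynomial.C r : ℝ[X]).comp (Polynomial.C a⁻¹ * (X - Polynomial.C b)) =
      Polynomial.C a⁻¹ * (X - Polynomial.C (a * r + b)) := fun r => by
    simp only [sub_comp, X_comp, C_comp, C_add, mul_sub, mul_add, ← C_mul]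
    rw [← mul_assoc, inv_mul_cancel₀ ha]
    simp only [one_mul]
    ring
  simp only [Function.comp_def, h2, Multiset.prod_map_mul, Multiset.map_const',
    Multiset.prod_replicate, C_mul, C_pow]
  ring

theorem HasRoots.shift {p q : List ℕ} {s : Multiset ℝ} (h : HasRoots p q s) :
    HasRoots (shift p) (shift q) (s.map fun r => r - 1) := by
  obtain ⟨hl, c, hc, hpq⟩ := h
  refine ⟨by rw [length_shift, length_shift, hl], ?_⟩
  have h2 : (toPoly (SixVertex.shift p) - toPoly (SixVertex.shift q)).comp
      (Polynomial.C 1 * X + Polynomial.C (-1)) =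
      Polynomial.C 1 * (toPoly p - toPoly q) := by
    rw [toPoly_shift, toPoly_shift, ← sub_comp, comp_assoc]
    simp
  exact (eq_prod_of_comp one_ne_zero one_ne_zero hc hpq h2).imp (by simp [sub_eq_add_neg])

theorem HasRoots.scale {p q : List ℕ} {s : Multiset ℝ} (h : HasRoots p q s) :
    HasRoots (scale p 0) (scale q 0) (s.map fun r => 2 * r) := by
  obtain ⟨hl, c, hc, hpq⟩ := h
  refine ⟨by rw [length_scale, length_scale, hl], ?_⟩
  have h2 : (toPoly (SixVertex.scale p 0) - toPoly (SixVertex.scale q 0)).comp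
      (Polynomial.C 2 * X + Polynomial.C 0) =
      Polynomial.C (2⁻¹ * 2 ^ p.length) * (toPoly p - toPoly q) := by
    have hp := toPoly_scale p 0
    have hq := toPoly_scale q 0
    rw [zero_add] at hp hq
    rw [C_0, add_zero, sub_comp, C_mul, mul_assoc, mul_sub, ← hp, hl, ← hq, ← mul_sub, ← mul_assoc,
      ← C_mul]
    simp
  exact (eq_prod_of_comp two_ne_zero (by positivity) hc hpq h2).imp (by simp)

/-- Descartes' rule of signs. -/
theorem HasRoots.countP_pos_le {p q : List ℕ} {s : Multiset ℝ} (h : HasRoots p q s) :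
    s.countP (0 < ·) ≤ variations false p q := by
  obtain ⟨hl, c, hc, hpq⟩ := h
  have := roots_countP_pos_le_signVariations (P := toPoly p - toPoly q)
  rw [variations_eq _ _ _ hl]
  simpa [altSign, hpq, roots_C_mul _ hc, roots_multiset_prod_X_sub_C] using this

/-- Descartes' rule of signs, with `-X` for `X`. -/
theorem HasRoots.countP_neg_le {p q : List ℕ} {s : Multiset ℝ} (h : HasRoots p q s) :
    s.countP (· < 0) ≤ variations true p q := by
  obtain ⟨hl, c, hc, hpq⟩ := h
  obtain ⟨c', hc', h'⟩ := eq_prod_of_comp (P := (toPoly p - toPoly q).comp (Polynomial.C (-1) * X))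
    (a := -1) (b := 0) (k := 1) (by norm_num) one_ne_zero hc hpq (by
      rw [comp_assoc]
      simp)
  have := roots_countP_pos_le_signVariations
    (P := (toPoly p - toPoly q).comp (Polynomial.C (-1) * X))
  rw [variations_eq _ _ _ hl]
  have h3 : (((altSign true : SignType)) : ℝ) = -1 := by simp [altSign]
  rw [h3]
  refine le_trans (le_of_eq ?_) this
  rw [h', roots_C_mul _ hc', roots_multiset_prod_X_sub_C, Multiset.countP_map,
    Multiset.countP_eq_card_filter]
  simp

/-- The total length that the intervals `[0, r]`, for `r` in `s`, cover inside `[0, 1]`. -/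
noncomputable def clampSum (s : Multiset ℝ) : ℝ := (s.map fun r => max 0 (min r 1)).sum

/-- The bisection step: the two halves of `[0, 1]` are stretched to `[0, 1]`. -/
theorem two_mul_clampSum (s : Multiset ℝ) :
    2 * clampSum s = clampSum (s.map fun r => 2 * r) + clampSum (s.map fun r => 2 * r - 1) := by
  simp only [clampSum, Multiset.map_map, Function.comp_def, ← Multiset.sum_map_mul_left,
    ← Multiset.sum_map_add]
  congr 1
  refine Multiset.map_congr rfl fun r _ => ?_
  rcases le_total r 0 with h0 | h0
  · rw [min_eq_left (by linarith), max_eq_left h0, min_eq_left (by linarith),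
      max_eq_left (by linarith), min_eq_left (by linarith), max_eq_left (by linarith)]
    norm_num
  rcases le_total r 1 with h1 | h1
  · rcases le_total (2 * r) 1 with h2 | h2
    · rw [min_eq_left h1, max_eq_right h0, min_eq_left h2, max_eq_right (by linarith),
        min_eq_left (by linarith), max_eq_left (by linarith)]
      ring
    · rw [min_eq_left h1, max_eq_right h0, min_eq_right h2, max_eq_right (by linarith),
        min_eq_left (by linarith), max_eq_right (by linarith)]
      ring
  · rw [min_eq_right h1, max_eq_right zero_le_one, min_eq_right (by linarith),
      max_eq_right zero_le_one, min_eq_right (by linarith), max_eq_right zero_le_one]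
    norm_num

theorem countP_le_clampSum (s : Multiset ℝ) : (s.countP (1 ≤ ·) : ℝ) ≤ clampSum s := by
  induction s using Multiset.induction_on with
  | empty => simp [clampSum]
  | cons r s ih =>
    simp only [clampSum, Multiset.map_cons, Multiset.sum_cons, Multiset.countP_cons] at ih ⊢
    split_ifs with h
    · rw [min_eq_right h, max_eq_right zero_le_one]
      push_cast
      linarith
    · have := le_max_left 0 (min r 1)
      push_cast
      linarith

theorem clampSum_le_countP (s : Multiset ℝ) : clampSum s ≤ (s.countP (0 < ·) : ℝ) := by
  induction s using Multiset.induction_on with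
  | empty => simp [clampSum]
  | cons r s ih =>
    simp only [clampSum, Multiset.map_cons, Multiset.sum_cons, Multiset.countP_cons] at ih ⊢
    split_ifs with h
    · have := max_le (zero_le_one (α := ℝ)) (min_le_right r 1)
      push_cast
      linarith
    · rw [max_eq_left (min_le_of_left_le (not_lt.1 h))]
      push_cast
      linarith

/-- All six roots are real. So an upper bound for the number of roots on one side of `a` is a lower
bound for the number of roots on the other side. -/
theorem six_sub_le_countP {s : Multiset ℝ} (hs : s.card = 6) {a : ℝ} {n : ℕ}
    (h : (s.map fun r => r - a).countP (· < 0) ≤ n) : Nat.sub 6 n ≤ s.countP (a ≤ ·) := by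
  have h1 := Multiset.card_eq_countP_add_countP (fun r => a ≤ r) s
  rw [Multiset.countP_map, ← Multiset.countP_eq_card_filter] at h
  have h2 : s.countP (fun r => ¬ a ≤ r) = s.countP fun r => r - a < 0 :=
    Multiset.countP_congr rfl fun r _ => by rw [sub_neg, not_le]
  change 6 - n ≤ _
  omega

/-- `clampBounds` encloses `2 ^ d * clampSum s`. -/
theorem clampBounds_spec (d : ℕ) {p q p₁ q₁ : List ℕ} {lo up : ℕ} {s : Multiset ℝ}
    (hs : s.card = 6) (h : HasRoots p q s) (h₁ : HasRoots p₁ q₁ (s.map fun r => r - 1))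
    (hlo : lo ≤ s.countP (1 ≤ ·)) (hup : s.countP (0 < ·) ≤ up) :
    ((clampBounds d p q p₁ q₁ lo up).1 : ℝ) ≤ 2 ^ d * clampSum s ∧
      2 ^ d * clampSum s ≤ (clampBounds d p q p₁ q₁ lo up).2 := by
  have hlo' : (lo : ℝ) ≤ clampSum s := le_trans (by exact_mod_cast hlo) (countP_le_clampSum s)
  have hup' : clampSum s ≤ up := (clampSum_le_countP s).trans (by exact_mod_cast hup)
  induction d generalizing p q p₁ q₁ lo up s with
  | zero => simpa [clampBounds] using ⟨hlo', hup'⟩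
  | succ d ih =>
    rw [clampBounds]
    cases hb : Nat.beq lo up with
    | true =>
      have hshift : ∀ n : ℕ, ((Nat.shiftLeft n (Nat.succ d) : ℕ) : ℝ) = 2 ^ (d + 1) * n := by
        intro n
        rw [show Nat.shiftLeft n (Nat.succ d) = n * 2 ^ (d + 1) from Nat.shiftLeft_eq _ _]
        push_cast
        ring
      simp only [cond_true, hshift]
      constructor <;> gcongr
    | false =>
      simp only [cond_false, force_eq, addPair, Nat.add_eq, Nat.cast_add]
      have hscale := h.scale
      have hmid : HasRoots (SixVertex.shift (SixVertex.scale p 0))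
          (SixVertex.shift (SixVertex.scale q 0)) (s.map fun r => 2 * r - 1) := by
        simpa [Multiset.map_map, Function.comp_def] using hscale.shift
      have hend : HasRoots (SixVertex.scale p₁ 0) (SixVertex.scale q₁ 0)
          ((s.map fun r => 2 * r - 1).map fun r => r - 1) := by
        convert h₁.scale using 1
        simp only [Multiset.map_map, Function.comp_def]
        exact Multiset.map_congr rfl fun r _ => by ring
      have hu := hmid.countP_pos_le
      have hl := six_sub_le_countP (s := s.map fun r => 2 * r) (by simpa using hs) (a := 1)
        (by simpa [Multiset.map_map, Function.comp_def] using hmid.countP_neg_le)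
      have hup2 : (s.map fun r => 2 * r).countP (0 < ·) ≤ up := by
        rw [Multiset.countP_map, ← Multiset.countP_eq_card_filter]
        refine (Multiset.countP_congr rfl fun r _ => ?_).trans_le hup
        exact propext ⟨fun h => by linarith, fun h => by linarith⟩
      have h2 := ih (s := s.map fun r => 2 * r) (up := up) (by simpa using hs) hscale
        (by simpa [Multiset.map_map, Function.comp_def] using hmid) hl
        hup2
        (le_trans (by exact_mod_cast hl) (countP_le_clampSum _))
        ((clampSum_le_countP _).trans (by exact_mod_cast hup2))
      have hlo2 : lo ≤ (s.map fun r => 2 * r - 1).countP (1 ≤ ·) := by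
        rw [Multiset.countP_map, ← Multiset.countP_eq_card_filter]
        refine hlo.trans_eq (Multiset.countP_congr rfl fun r _ => ?_)
        exact propext ⟨fun h => by linarith, fun h => by linarith⟩
      have h3 := ih (s := s.map fun r => 2 * r - 1) (by simpa using hs) hmid hend hlo2 hu
        (le_trans (by exact_mod_cast hlo2) (countP_le_clampSum _))
        ((clampSum_le_countP _).trans (by exact_mod_cast hu))
      have h4 := two_mul_clampSum s
      have h5 : (2 : ℝ) ^ (d + 1) * clampSum s =
          2 ^ d * clampSum (s.map fun r => 2 * r) +
            2 ^ d * clampSum (s.map fun r => 2 * r - 1) := by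
        rw [pow_succ, mul_assoc, h4]
        ring
      rw [h5]
      exact ⟨add_le_add h2.1 h3.1, add_le_add h2.2 h3.2⟩

/-! ### Characteristic polynomials and energies -/

/-- Newton's identities for six numbers with sum zero, with the denominators cleared. -/
theorem newton_identities (x : Fin 6 → ℝ) {p₂ p₃ p₄ p₅ p₆ : ℝ} (h₁ : ∑ i, x i = 0)
    (h₂ : ∑ i, x i ^ 2 = p₂) (h₃ : ∑ i, x i ^ 3 = p₃) (h₄ : ∑ i, x i ^ 4 = p₄)
    (h₅ : ∑ i, x i ^ 5 = p₅) (h₆ : ∑ i, x i ^ 6 = p₆) :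
    Polynomial.C 720 * (∏ i, (X - Polynomial.C (x i)) : ℝ[X]) =
      Polynomial.C 720 * X ^ 6 - Polynomial.C (360 * p₂) * X ^ 4 - Polynomial.C (240 * p₃) * X ^ 3 +
        Polynomial.C (90 * p₂ ^ 2 - 180 * p₄) * X ^ 2 +
        Polynomial.C (120 * p₂ * p₃ - 144 * p₅) * X +
        Polynomial.C (90 * p₂ * p₄ + 40 * p₃ ^ 2 - 15 * p₂ ^ 3 - 120 * p₆) := by
  have hP : ∀ k, MvPolynomial.aeval x (MvPolynomial.psum (Fin 6) ℝ k) = ∑ i, x i ^ k := fun k => by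
    simp [MvPolynomial.psum]
  have hE : ∀ k, MvPolynomial.aeval x (MvPolynomial.esymm (Fin 6) ℝ k) =
      (Finset.univ.val.map x).esymm k := fun k =>
    MvPolynomial.aeval_esymm_eq_multiset_esymm (Fin 6) ℝ k x
  have key := fun k => congrArg (MvPolynomial.aeval x) (MvPolynomial.mul_esymm_eq_sum (Fin 6) ℝ k)
  simp only [Finset.sum_filter, Finset.Nat.sum_antidiagonal_eq_sum_range_succ_mk, map_mul, map_sum,
    map_pow, map_neg, map_one, map_natCast, apply_ite (MvPolynomial.aeval x), map_zero, hE, hP]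
    at key
  have hprod := Multiset.prod_X_sub_X_eq_sum_esymm (Finset.univ.val.map x)
  rw [Multiset.map_map] at hprod
  have e₀ : (Finset.univ.val.map x).esymm 0 = 1 := by simp [Multiset.esymm]
  rw [Finset.prod_eq_multiset_prod,
    show (fun i => X - Polynomial.C (x i)) = (fun t => X - Polynomial.C t) ∘ x from rfl,
    hprod]
  clear hprod hE
  generalize (Finset.univ.val.map x).esymm = E at *
  have k₁ := key 1
  have k₂ := key 2
  have k₃ := key 3
  have k₄ := key 4
  have k₅ := key 5
  have k₆ := key 6
  norm_num [Finset.sum_range_succ, e₀, h₁, h₂, h₃, h₄, h₅, h₆] at k₁ k₂ k₃ k₄ k₅ k₆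
  simp only [k₁, zero_mul] at k₃ k₄ k₅ k₆
  simp only [Multiset.card_map, Finset.card_val, Finset.card_univ, Fintype.card_fin,
    Finset.sum_range_succ, Finset.sum_range_zero, e₀, k₁]
  have c₂ : 720 * E 2 = -(360 * p₂) := by linear_combination 360 * k₂
  have c₃ : 720 * E 3 = 240 * p₃ := by linear_combination 240 * k₃
  have c₄ : 720 * E 4 = 90 * p₂ ^ 2 - 180 * p₄ := by
    linear_combination 180 * k₄ - 90 * p₂ * k₂
  have c₅ : 720 * E 5 = 144 * p₅ - 120 * p₂ * p₃ := by
    linear_combination 144 * k₅ + 72 * p₃ * k₂ - 48 * p₂ * k₃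
  have c₆ : 720 * E 6 = 90 * p₂ * p₄ + 40 * p₃ ^ 2 - 15 * p₂ ^ 3 - 120 * p₆ := by
    linear_combination 120 * k₆ - 60 * p₄ * k₂ + 40 * p₃ * k₃ - 30 * p₂ * k₄ + 15 * p₂ ^ 2 * k₂
  have d := fun {a b : ℝ} (h : a = b) => congrArg (Polynomial.C : ℝ → ℝ[X]) h
  have d₂ := d c₂
  have d₃ := d c₃
  have d₄ := d c₄
  have d₅ := d c₅
  have d₆ := d c₆
  simp only [C_mul, C_neg, C_sub, C_add, C_pow, map_one, map_zero] at d₂ d₃ d₄ d₅ d₆ ⊢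
  linear_combination X ^ 4 * d₂ - X ^ 3 * d₃ + X ^ 2 * d₄ - X * d₅ + d₆

theorem sum_eigenvalues_pow {n : Type*} [Fintype n] [DecidableEq n] {A : Matrix n n ℝ}
    (hA : A.IsHermitian) (k : ℕ) : ∑ i, hA.eigenvalues i ^ k = (A ^ k).trace := by
  conv_rhs => rw [hA.spectral_theorem, ← map_pow, Matrix.diagonal_pow,
    Unitary.conjStarAlgAut_apply, Matrix.trace_mul_cycle]
  simp [Matrix.trace_diagonal]

open Classical in
/-- The energy can be read off from any matrix that is the adjacency matrix up to a relabelling. -/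
theorem energy_eq_sum_roots {G : FinGraph} {ι : Type} [Fintype ι] [DecidableEq ι] (e : G.V ≃ ι)
    {B : Matrix ι ι ℝ} (hB : ∀ i j, B (e i) (e j) = if G.graph.Adj i j then 1 else 0) :
    G.energy = (B.charpoly.roots.map fun x => |x|).sum := by
  have h : Matrix.reindex e e (G.graph.adjMatrix ℝ) = B := by
    ext i j
    rw [Matrix.reindex_apply, Matrix.submatrix_apply, SimpleGraph.adjMatrix_apply, ← hB,
      e.apply_symm_apply, e.apply_symm_apply]
  rw [← h, Matrix.charpoly_reindex, G.isHermitian_adjMatrix.roots_charpoly_eq_eigenvalues,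
    Multiset.map_map]
  rfl

open Classical in
theorem energy_congr {G H : FinGraph} (h : G.Iso H) : G.energy = H.energy := by
  obtain ⟨φ⟩ := h
  rw [energy_eq_sum_roots (Equiv.refl H.V) (B := H.graph.adjMatrix ℝ) fun i j => rfl]
  refine energy_eq_sum_roots φ.toEquiv fun i j => ?_
  rw [SimpleGraph.adjMatrix_apply]
  exact if_congr φ.map_adj_iff rfl rfl

theorem deleteVertex_iso {G H : FinGraph} (φ : G.graph ≃g H.graph) (v : G.V) :
    (G.deleteVertex v).Iso (H.deleteVertex (φ v)) :=
  ⟨{ toEquiv := φ.toEquiv.subtypeEquiv fun w => by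
        simp
     map_rel_iff' := φ.map_adj_iff }⟩

theorem localEnergy_congr {G H : FinGraph} (h : G.Iso H) : G.localEnergy = H.localEnergy := by
  obtain ⟨φ⟩ := h
  exact Fintype.sum_equiv φ.toEquiv _ _ fun v => by
    rw [FinGraph.localEnergyAt, FinGraph.localEnergyAt, energy_congr ⟨φ⟩,
      energy_congr (deleteVertex_iso φ v)]
    rfl

theorem order_congr {G H : FinGraph} (h : G.Iso H) : G.order = H.order := by
  obtain ⟨φ⟩ := h
  exact Fintype.card_congr φ.toEquiv

open Classical in
/-- Isolating a vertex has the same effect on the energy as deleting it: it merely adds an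
eigenvalue `0`. -/
theorem energy_deleteVertex_eq {G H : FinGraph} (e : G.V ≃ H.V) (v : G.V)
    (h : ∀ i j, H.graph.Adj (e i) (e j) ↔ G.graph.Adj i j ∧ i ≠ v ∧ j ≠ v) :
    (G.deleteVertex v).energy = H.energy := by
  let B : Matrix {w : G.V // w ≠ v} {w : G.V // w ≠ v} ℝ :=
    Matrix.of fun i j => if G.graph.Adj i j then 1 else 0
  let f : H.V ≃ {w : G.V // w ≠ v} ⊕ {w : G.V // ¬ w ≠ v} :=
    e.symm.trans (Equiv.sumCompl (· ≠ v)).symm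
  rw [energy_eq_sum_roots (G := G.deleteVertex v) (Equiv.refl {w : G.V // w ≠ v}) (B := B)
      fun i j => rfl,
    energy_eq_sum_roots f (B := Matrix.fromBlocks B 0 0 0),
    Matrix.charpoly_fromBlocks_zero₁₂, Matrix.charpoly_zero, Polynomial.roots_mul,
    Multiset.map_add, Multiset.sum_add, Polynomial.roots_X_pow]
  · simp
  · exact mul_ne_zero (Matrix.charpoly_monic B).ne_zero (pow_ne_zero _ X_ne_zero)
  · suffices ∀ i j, Matrix.fromBlocks B 0 0 0 i j =
        if H.graph.Adj (f.symm i) (f.symm j) then 1 else 0 from fun i j => by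
      rw [this, f.symm_apply_apply, f.symm_apply_apply]
    have hf : ∀ i, f.symm i = e (Equiv.sumCompl (· ≠ v) i) := fun i => rfl
    rintro (i | i) (j | j)
    · simp [hf, h, B, i.2, j.2]
    · have := not_not.1 j.2
      simp [hf, h, this]
    · have := not_not.1 i.2
      simp [hf, h, this]
    · have := not_not.1 i.2
      simp [hf, h, this]

theorem cast_sum6 (f : ℕ → ℕ) : ((sum6 f : ℕ) : ℝ) = ∑ i : Fin 6, (f i : ℝ) := by
  simp only [sum6, Nat.add_eq, Nat.cast_add, Fin.sum_univ_six]
  simp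
  ring

theorem cast_pairing (f g : ℕ → ℕ → ℕ) : ((pairing f g : ℕ) : ℝ) =
    ((Matrix.of fun i j : Fin 6 => (f i j : ℝ)) *
      (Matrix.of fun i j : Fin 6 => (g i j : ℝ))).trace := by
  simp [pairing, cast_sum6, Matrix.trace, Matrix.mul_apply]

/-- The adjacency matrix of the graph with code `m`. -/
noncomputable def codeMatrix (m : ℕ) : Matrix (Fin 6) (Fin 6) ℝ :=
  Matrix.of fun i j => (entry m i j : ℝ)

theorem of_entry (m : ℕ) : (Matrix.of fun i j : Fin 6 => (entry m i j : ℝ)) = codeMatrix m := rfl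

theorem of_entry₂ (m : ℕ) : (Matrix.of fun i j : Fin 6 => (entry₂ m i j : ℝ)) =
    codeMatrix m * codeMatrix m := by
  ext i j
  simp [entry₂, cast_sum6, codeMatrix, Matrix.mul_apply]

theorem of_entry₃ (m : ℕ) : (Matrix.of fun i j : Fin 6 => (entry₃ m i j : ℝ)) =
    codeMatrix m * (codeMatrix m * codeMatrix m) := by
  rw [← of_entry₂]
  ext i j
  simp [entry₃, cast_sum6, codeMatrix, Matrix.mul_apply]

theorem codeMatrix_isHermitian (m : ℕ) : (codeMatrix m).IsHermitian := by
  ext i j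
  simp [codeMatrix, entry, adj_comm 6 m i j]

/-- The spectrum of the graph with code `m`, with its power sums. -/
theorem exists_spectrum (m : ℕ) : ∃ x : Fin 6 → ℝ, (ofCode m).energy = ∑ i, |x i| ∧
    ∑ i, x i = 0 ∧ ∑ i, x i ^ 2 = pairing (entry m) (entry m) ∧
    ∑ i, x i ^ 3 = pairing (entry m) (entry₂ m) ∧ ∑ i, x i ^ 4 = pairing (entry₂ m) (entry₂ m) ∧
    ∑ i, x i ^ 5 = pairing (entry₂ m) (entry₃ m) ∧
    ∑ i, x i ^ 6 = pairing (entry₃ m) (entry₃ m) := by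
  have h := fun k => sum_eigenvalues_pow (codeMatrix_isHermitian m) k
  refine ⟨(codeMatrix_isHermitian m).eigenvalues, ?_, ?_, ?_, ?_, ?_, ?_, ?_⟩
  · rw [energy_eq_sum_roots (G := ofCode m) (Equiv.refl (Fin 6)) (B := codeMatrix m) ?_,
      (codeMatrix_isHermitian m).roots_charpoly_eq_eigenvalues, Multiset.map_map]
    · rfl
    · intro (i : Fin 6) (j : Fin 6)
      have h1 : ((entry m i j : ℕ) : ℝ) = if adj 6 m i j = true then 1 else 0 := by
        unfold entry
        cases adj 6 m i j <;> simp
      by_cases h2 : adj 6 m i j = true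
      · exact (h1.trans (if_pos h2)).trans
          (if_pos (show (ofCode m).graph.Adj i j from h2)).symm
      · exact (h1.trans (if_neg h2)).trans
          (if_neg (show ¬ (ofCode m).graph.Adj i j from h2)).symm
  · have h1 := h 1
    simp only [pow_one] at h1
    rw [h1]
    simp [codeMatrix, Matrix.trace, entry, adj_self]
  all_goals
    rw [h, cast_pairing]
    simp only [of_entry₂, of_entry₃, of_entry, pow_succ, pow_zero, one_mul, mul_assoc]

theorem entry_le_one (m i j : ℕ) : entry m i j ≤ 1 := by
  unfold entry
  cases adj 6 m i j <;> simp

/-- Encloses `2 ^ 22` times the energy. -/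
theorem energyBounds_spec (m : ℕ) : ((energyBounds m).1 : ℝ) ≤ 2 ^ 22 * (ofCode m).energy ∧
    2 ^ 22 * (ofCode m).energy ≤ (energyBounds m).2 := by
  obtain ⟨x, hx, h₁, h₂, h₃, h₄, h₅, h₆⟩ := exists_spectrum m
  simp only [energyBounds, withWalks, force_eq]
  have hp₂ : (pairing (entry m) (entry m) : ℝ) ≤ 36 := by
    rw [cast_pairing]
    simp only [Matrix.trace, Matrix.diag_apply, Matrix.mul_apply, Matrix.of_apply]
    calc ∑ i : Fin 6, ∑ j : Fin 6, (entry m i j : ℝ) * entry m j i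
        ≤ ∑ i : Fin 6, ∑ j : Fin 6, (1 : ℝ) := by
          refine Finset.sum_le_sum fun i _ => Finset.sum_le_sum fun j _ => ?_
          exact_mod_cast Nat.mul_le_mul (entry_le_one m i j) (entry_le_one m j i)
      _ = 36 := by norm_num
  generalize pairing (entry m) (entry m) = p₂ at *
  generalize pairing (entry m) (entry₂ m) = p₃ at *
  generalize pairing (entry₂ m) (entry₂ m) = p₄ at *
  generalize pairing (entry₂ m) (entry₃ m) = p₅ at *
  generalize pairing (entry₃ m) (entry₃ m) = p₆ at *
  have hN := newton_identities x h₁ h₂ h₃ h₄ h₅ h₆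
  set s : Multiset ℝ := Finset.univ.val.map fun i => 1 / 8 * x i with hs
  have hroots : HasRoots (posPart p₂ p₃ p₄) (negPart p₂ p₃ p₄ p₅ p₆) s := by
    refine ⟨rfl, ?_⟩
    have := eq_prod_of_comp (s := Finset.univ.val.map x)
      (P := toPoly (posPart p₂ p₃ p₄) - toPoly (negPart p₂ p₃ p₄ p₅ p₆))
      (Q := Polynomial.C 720 * (∏ i, (X - Polynomial.C (x i)) : ℝ[X]))
      (a := 1 / 8) (b := 0) (c := 720) (k := 1)
      (by norm_num) one_ne_zero (by norm_num)
      (by rw [Multiset.map_map]; rfl)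
      (by
        rw [hN]
        refine Polynomial.funext fun t => ?_
        simp [posPart, negPart, toPoly]
        ring)
    simpa [hs, Multiset.map_map, Function.comp_def] using this
  have hcard : s.card = 6 := by simp [hs]
  have hb := clampBounds_spec 26 hcard hroots hroots.shift
    (six_sub_le_countP hcard hroots.shift.countP_neg_le) hroots.countP_pos_le
  have hclamp : (ofCode m).energy = 16 * clampSum s := by
    -- The eigenvalues sum to `0`, so the energy is twice the sum of the positive eigenvalues.
    have habs : ∀ i, |x i| = 16 * max 0 (min (1 / 8 * x i) 1) - x i := fun i => by
      have h1 : x i ^ 2 ≤ p₂ := by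
        rw [← h₂]
        exact Finset.single_le_sum (f := fun i => x i ^ 2) (fun i _ => sq_nonneg _)
          (Finset.mem_univ i)
      have h2 : x i ≤ 8 := by nlinarith
      rw [min_eq_left (by linarith)]
      rcases le_total 0 (x i) with h | h
      · rw [abs_of_nonneg h, max_eq_right (by linarith)]
        ring
      · rw [abs_of_nonpos h, max_eq_left (by linarith)]
        ring
    have h2 : clampSum s = ∑ i, max 0 (min (1 / 8 * x i) 1) := by
      simp only [clampSum, hs, Multiset.map_map]
      rfl
    rw [hx, h2, Finset.sum_congr rfl fun i _ => habs i, Finset.sum_sub_distrib, h₁, sub_zero,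
      Finset.mul_sum]
  have h5 : (2 : ℝ) ^ 22 * (ofCode m).energy = 2 ^ 26 * clampSum s := by
    rw [hclamp]
    ring
  rw [h5]
  exact hb

theorem adj_keep : ∀ v i j : Fin 6, i ≠ j → adj 6 (keep v) i j = (i != v && j != v) := by
  decide +kernel

theorem adj_land (m n i j : ℕ) : adj 6 (Nat.land m n) i j = (adj 6 m i j && adj 6 n i j) := by
  have h : ∀ k, digit (m &&& n) k = (digit m k && digit n k) := fun k => by
    simp only [digit_eq_testBit]
    exact Nat.testBit_and m n k
  unfold adj
  cases Nat.blt i j <;> cases Nat.blt j i <;> simp [h]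

theorem energy_deleteVertex_ofCode (m : ℕ) (v : Fin 6) :
    ((ofCode m).deleteVertex v).energy = (ofCode (Nat.land m (keep v))).energy := by
  refine energy_deleteVertex_eq (G := ofCode m) (H := ofCode (Nat.land m (keep v)))
    (Equiv.refl (Fin 6)) v ?_
  intro (i : Fin 6) (j : Fin 6)
  change adj 6 (Nat.land m (keep v)) i j = true ↔ adj 6 m i j = true ∧ i ≠ v ∧ j ≠ v
  rw [adj_land]
  by_cases hij : i = j
  · simp [hij, adj_self]
  · simp [adj_keep v i j hij]

theorem localEnergy_ofCode (m : ℕ) : (ofCode m).localEnergy =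
    6 * (ofCode m).energy - ∑ v : Fin 6, (ofCode (Nat.land m (keep v))).energy := by
  have h : (ofCode m).localEnergy = ∑ v : Fin 6, ((ofCode m).energy -
      (ofCode (Nat.land m (keep v))).energy) := by
    refine Finset.sum_congr rfl fun (v : Fin 6) _ => ?_
    rw [← energy_deleteVertex_ofCode]
    rfl
  rw [h, Finset.sum_sub_distrib]
  simp

/-- Encloses `2 ^ 22` times the two terms of the local energy. -/
theorem localBounds_spec (m : ℕ) : ∃ x y : ℝ, 2 ^ 22 * (ofCode m).localEnergy = x - y ∧
    ((localBounds m).1 : ℝ) ≤ x ∧ x ≤ (localBounds m).2.1 ∧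
    ((localBounds m).2.2.1 : ℝ) ≤ y ∧ y ≤ (localBounds m).2.2.2 := by
  refine ⟨6 * (2 ^ 22 * (ofCode m).energy),
    ∑ v : Fin 6, 2 ^ 22 * (ofCode (Nat.land m (keep v))).energy, ?_, ?_⟩
  · rw [localEnergy_ofCode, ← Finset.mul_sum]
    ring
  · simp only [localBounds, force_eq, cast_sum6, Nat.mul_eq, Nat.cast_mul, Nat.cast_ofNat]
    have h := energyBounds_spec m
    refine ⟨?_, ?_, ?_, ?_⟩
    · linarith
    · linarith
    · exact Finset.sum_le_sum fun v _ => (energyBounds_spec _).1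
    · exact Finset.sum_le_sum fun v _ => (energyBounds_spec _).2

end SixVertex

namespace SixVertex

/-! ### The finite computation -/

/-- The comparison of the local energies of all 156 graphs on six vertices. -/
theorem allPairs_separated_reps :
    (allPairs separated (reps 6) && (codes₁ ++ codes₂ ++ codes₃).all (reps 6).contains) = true := by
  decide +kernel

/-- The graphs on the three lists and their vertex-deleted subgraphs have integral eigenvalues,
where bisection is exact. The only exception is `C₅ ∪ K₁`, with code `684`. -/
theorem exactly_codes : (codes₁.all (exactly 12) && [5871, 616].all (exactly 10) &&
    codes₃.all (exactly 8)) = true := by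
  decide +kernel

/-! ### What the computation says about local energies -/

theorem allPairs_spec {r : ℕ → ℕ → Bool} {l : List ℕ} (h : allPairs r l = true) {a b : ℕ}
    (ha : a ∈ l) (hb : b ∈ l) : a = b ∨ r a b = true ∨ r b a = true := by
  induction l with
  | nil => simp at ha
  | cons c l ih =>
    rw [allPairs, Bool.and_eq_true, List.all_eq_true] at h
    rcases List.mem_cons.1 ha with rfl | ha'
    · rcases List.mem_cons.1 hb with rfl | hb'
      · exact Or.inl rfl
      · exact Or.inr (Or.inl (h.1 _ hb'))
    · rcases List.mem_cons.1 hb with rfl | hb'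
      · exact Or.inr (Or.inr (h.1 _ ha'))
      · exact ih h.2 ha' hb'

theorem localEnergy_lt_of_below {m n : ℕ} (h : below (localBounds m) (localBounds n) = true) :
    (ofCode m).localEnergy < (ofCode n).localEnergy := by
  obtain ⟨x, y, hxy, h1, h2, h3, h4⟩ := localBounds_spec m
  obtain ⟨x', y', hxy', h1', h2', h3', h4'⟩ := localBounds_spec n
  rw [below, Nat.blt_eq] at h
  have h' : ((localBounds m).2.1 : ℝ) + (localBounds n).2.2.2 <
      (localBounds n).1 + (localBounds m).2.2.1 := by exact_mod_cast h
  have : (2 : ℝ) ^ 22 * (ofCode m).localEnergy < 2 ^ 22 * (ofCode n).localEnergy := by linarith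
  exact lt_of_mul_lt_mul_left this (by positivity)

/-- Distinct codes on no common list belong to graphs with different local energies. -/
theorem eq_or_sameClass {m n : ℕ} (hm : m ∈ reps 6) (hn : n ∈ reps 6)
    (h : (ofCode m).localEnergy = (ofCode n).localEnergy) : m = n ∨ sameClass m n = true := by
  have key : ∀ a b : ℕ, (ofCode a).localEnergy = (ofCode b).localEnergy → separated a b = true →
      sameClass a b = true := fun a b hab hs => by
    rw [separated, Bool.or_eq_true, Bool.or_eq_true] at hs
    rcases hs with (hs | hs) | hs
    · exact absurd hab (localEnergy_lt_of_below hs).ne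
    · exact absurd hab (localEnergy_lt_of_below hs).ne'
    · exact hs
  rcases allPairs_spec (Bool.and_eq_true_iff.1 allPairs_separated_reps).1 hm hn with h' | h' | h'
  · exact Or.inl h'
  · exact Or.inr (key _ _ h h')
  · have := key _ _ h.symm h'
    refine Or.inr ?_
    simpa only [sameClass, Bool.and_comm] using this

theorem mem_reps_of_mem_codes {m : ℕ} (h : m ∈ codes₁ ++ codes₂ ++ codes₃) : m ∈ reps 6 := by
  have := List.all_eq_true.1 (Bool.and_eq_true_iff.1 allPairs_separated_reps).2 m h
  simpa using this

theorem localEnergy_eq_of_exactly {v m : ℕ} (h : exactly v m = true) :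
    (ofCode m).localEnergy = v := by
  obtain ⟨x, y, hxy, h1, h2, h3, h4⟩ := localBounds_spec m
  simp only [exactly, Bool.and_eq_true, Nat.beq_eq] at h
  obtain ⟨⟨ha, hb⟩, hc⟩ := h
  have hc' : ((localBounds m).1 : ℝ) = (localBounds m).2.2.1 + v * 2 ^ 22 := by exact_mod_cast hc
  rw [← ha] at h2
  rw [← hb] at h4
  have : (2 : ℝ) ^ 22 * (ofCode m).localEnergy = 2 ^ 22 * v := by linarith
  exact mul_left_cancel₀ (by positivity) this

/-! ### The local energy of `C₅ ∪ K₁` -/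

open Polynomial in
/-- Six reals that sum to zero are determined, up to their order, by their next five power sums. So
the spectrum of a graph can be checked on its numbers of closed walks. -/
theorem energy_eq_of_walks {m p₂ p₃ p₄ p₅ p₆ : ℕ} (h : walks m = [p₂, p₃, p₄, p₅, p₆])
    (y : Fin 6 → ℝ) (h₁ : ∑ i, y i = 0) (h₂ : ∑ i, y i ^ 2 = p₂) (h₃ : ∑ i, y i ^ 3 = p₃)
    (h₄ : ∑ i, y i ^ 4 = p₄) (h₅ : ∑ i, y i ^ 5 = p₅) (h₆ : ∑ i, y i ^ 6 = p₆) :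
    (ofCode m).energy = ∑ i, |y i| := by
  obtain ⟨x, hx, g₁, g₂, g₃, g₄, g₅, g₆⟩ := exists_spectrum m
  simp only [walks, withWalks, force_eq, List.cons.injEq, and_true] at h
  obtain ⟨e₂, e₃, e₄, e₅, e₆⟩ := h
  rw [e₂] at g₂
  rw [e₃] at g₃
  rw [e₄] at g₄
  rw [e₅] at g₅
  rw [e₆] at g₆
  have hprod : (∏ i, (X - C (x i)) : ℝ[X]) = ∏ i, (X - C (y i)) := by
    refine mul_left_cancel₀ (C_ne_zero.2 (by norm_num : (720 : ℝ) ≠ 0)) ?_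
    rw [newton_identities x g₁ g₂ g₃ g₄ g₅ g₆, newton_identities y h₁ h₂ h₃ h₄ h₅ h₆]
  have hroots : Finset.univ.val.map x = Finset.univ.val.map y := by
    have h := congrArg roots hprod
    have hr : ∀ z : Fin 6 → ℝ, (∏ i, (X - C (z i)) : ℝ[X]).roots = Finset.univ.val.map z := by
      intro z
      rw [← roots_multiset_prod_X_sub_C (Finset.univ.val.map z), Multiset.map_map]
      rfl
    rwa [hr, hr] at h
  have := congrArg (fun s => (s.map fun t : ℝ => |t|).sum) hroots
  rw [hx]
  rw [Multiset.map_map, Multiset.map_map] at this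
  exact this

/-- The powers of a root of `t ^ 2 = t + 1` have Fibonacci coefficients. -/
theorem pow_of_sq_eq {t : ℝ} (h : t ^ 2 = t + 1) :
    t ^ 3 = 2 * t + 1 ∧ t ^ 4 = 3 * t + 2 ∧ t ^ 5 = 5 * t + 3 ∧ t ^ 6 = 8 * t + 5 := by
  refine ⟨?_, ?_, ?_, ?_⟩
  · linear_combination (t + 1) * h
  · linear_combination (t ^ 2 + t + 2) * h
  · linear_combination (t ^ 3 + t ^ 2 + 2 * t + 3) * h
  · linear_combination (t ^ 4 + t ^ 3 + 2 * t ^ 2 + 3 * t + 5) * h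

/-- The eigenvalues of the pentagon are `2` and the negatives of the two roots of
`t ^ 2 = t + 1`, each of them twice. -/
theorem energy_of_pentagon {m : ℕ} (h : walks m = [10, 0, 30, 10, 100]) {s t : ℝ}
    (hs : s ^ 2 = s + 1) (ht : t ^ 2 = t + 1) (hst : s + t = 1) (hs₀ : 0 < s) (ht₀ : t < 0) :
    (ofCode m).energy = 2 + 2 * (s - t) := by
  obtain ⟨a₃, a₄, a₅, a₆⟩ := pow_of_sq_eq hs
  obtain ⟨b₃, b₄, b₅, b₆⟩ := pow_of_sq_eq ht
  rw [energy_eq_of_walks h ![0, 2, -s, -s, -t, -t]]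
  · simp [Fin.sum_univ_six, abs_of_pos hs₀, abs_of_neg ht₀]
    ring
  all_goals simp [Fin.sum_univ_six]
  · linear_combination -2 * hst
  · linear_combination 2 * hs + 2 * ht + 2 * hst
  · linear_combination -2 * a₃ - 2 * b₃ - 4 * hst
  · linear_combination 2 * a₄ + 2 * b₄ + 6 * hst
  · linear_combination -2 * a₅ - 2 * b₅ - 10 * hst
  · linear_combination 2 * a₆ + 2 * b₆ + 16 * hst

/-- The eigenvalues of the path on four vertices are the two roots of `t ^ 2 = t + 1` and their
negatives. -/
theorem energy_of_path {m : ℕ} (h : walks m = [6, 0, 14, 0, 36]) {s t : ℝ}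
    (hs : s ^ 2 = s + 1) (ht : t ^ 2 = t + 1) (hst : s + t = 1) (hs₀ : 0 < s) (ht₀ : t < 0) :
    (ofCode m).energy = 2 * (s - t) := by
  obtain ⟨a₃, a₄, a₅, a₆⟩ := pow_of_sq_eq hs
  obtain ⟨b₃, b₄, b₅, b₆⟩ := pow_of_sq_eq ht
  rw [energy_eq_of_walks h ![0, 0, s, -s, t, -t]]
  · simp [Fin.sum_univ_six, abs_of_pos hs₀, abs_of_neg ht₀]
    ring
  all_goals simp [Fin.sum_univ_six]
  · linear_combination 2 * hs + 2 * ht + 2 * hst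
  · ring
  · linear_combination 2 * a₄ + 2 * b₄ + 6 * hst
  · ring
  · linear_combination 2 * a₆ + 2 * b₆ + 16 * hst

theorem walks_pentagon : walks 684 = [10, 0, 30, 10, 100] ∧
    (List.range 6).map (fun v => walks (Nat.land 684 (keep v))) =
      [10, 0, 30, 10, 100] :: List.replicate 5 [6, 0, 14, 0, 36] := by
  decide +kernel

open Real in
/-- Deleting the isolated vertex keeps the pentagon; deleting another vertex leaves a path. -/
theorem localEnergy_pentagon : (ofCode 684).localEnergy = (10 : ℕ) := by
  obtain ⟨h, h'⟩ := walks_pentagon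
  simp only [List.range, List.range.loop, List.map_cons, List.map_nil, List.replicate,
    List.cons.injEq, and_true] at h'
  obtain ⟨h0, h1, h2, h3, h4, h5⟩ := h'
  rw [localEnergy_ofCode, Fin.sum_univ_six]
  change 6 * (ofCode 684).energy - ((ofCode (Nat.land 684 (keep 0))).energy +
    (ofCode (Nat.land 684 (keep 1))).energy + (ofCode (Nat.land 684 (keep 2))).energy +
    (ofCode (Nat.land 684 (keep 3))).energy + (ofCode (Nat.land 684 (keep 4))).energy +
    (ofCode (Nat.land 684 (keep 5))).energy) = _
  have hC := fun {m : ℕ} (h : walks m = [10, 0, 30, 10, 100]) =>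
    energy_of_pentagon h goldenRatio_sq goldenConj_sq goldenRatio_add_goldenConj goldenRatio_pos
      goldenConj_neg
  have hP := fun {m : ℕ} (h : walks m = [6, 0, 14, 0, 36]) =>
    energy_of_path h goldenRatio_sq goldenConj_sq goldenRatio_add_goldenConj goldenRatio_pos
      goldenConj_neg
  rw [hC h, hC h0, hP h1, hP h2, hP h3, hP h4, hP h5]
  push_cast
  ring

/-- The common values of the local energy in the three classes. -/
theorem localEnergy_codes :
    (∀ m ∈ codes₁, (ofCode m).localEnergy = (12 : ℕ)) ∧
    (∀ m ∈ codes₂, (ofCode m).localEnergy = (10 : ℕ)) ∧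
    ∀ m ∈ codes₃, (ofCode m).localEnergy = (8 : ℕ) := by
  have h := exactly_codes
  rw [Bool.and_eq_true, Bool.and_eq_true, List.all_eq_true, List.all_eq_true,
    List.all_eq_true] at h
  obtain ⟨⟨h1, h2⟩, h3⟩ := h
  refine ⟨fun m hm => localEnergy_eq_of_exactly (h1 m hm), fun m hm => ?_,
    fun m hm => localEnergy_eq_of_exactly (h3 m hm)⟩
  by_cases hm' : m = 684
  · rw [hm']
    exact localEnergy_pentagon
  · exact localEnergy_eq_of_exactly (h2 m (by simp_all [codes₂]))

/-! ### The graphs on the three lists -/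

theorem iso_symm {G H : FinGraph} (h : G.Iso H) : H.Iso G := h.map SimpleGraph.Iso.symm

theorem iso_trans {G H F : FinGraph} (h : G.Iso H) (h' : H.Iso F) : G.Iso F := by
  obtain ⟨φ⟩ := h
  obtain ⟨ψ⟩ := h'
  exact ⟨φ.trans ψ⟩

instance (n : ℕ) : DecidableEq (K n).V := inferInstanceAs (DecidableEq (Fin n))
instance (n : ℕ) : DecidableEq (C n).V := inferInstanceAs (DecidableEq (Fin n))
instance (G H : FinGraph) [DecidableEq G.V] [DecidableEq H.V] : DecidableEq (G ∪ H).V :=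
  inferInstanceAs (DecidableEq (G.V ⊕ H.V))
instance (n : ℕ) : DecidableRel (K n).graph.Adj :=
  inferInstanceAs (DecidableRel (⊤ : SimpleGraph (Fin n)).Adj)
instance (n : ℕ) : DecidableRel (C n).graph.Adj :=
  inferInstanceAs (DecidableRel (SimpleGraph.cycleGraph n).Adj)
instance (G H : FinGraph) [DecidableRel G.graph.Adj] [DecidableRel H.graph.Adj] :
    DecidableRel (G ∪ H).graph.Adj := fun
  | .inl x, .inl y => inferInstanceAs (Decidable (G.graph.Adj x y))
  | .inr x, .inr y => inferInstanceAs (Decidable (H.graph.Adj x y))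
  | .inl _, .inr _ => isFalse (by rintro ⟨⟩)
  | .inr _, .inl _ => isFalse (by rintro ⟨⟩)

instance (n k : ℕ) [NeZero n] : OfNat (K n).V k := inferInstanceAs (OfNat (Fin n) k)
instance (n k : ℕ) [NeZero n] : OfNat (C n).V k := inferInstanceAs (OfNat (Fin n) k)

/-- An isomorphism given by the list of the vertices of `G`. -/
theorem iso_ofCode {G : FinGraph} (f : Fin 6 → G.V) (m : ℕ) (hG : Fintype.card G.V = 6)
    (hf : Function.Injective f)
    (h : ∀ i j : Fin 6, G.graph.Adj (f i) (f j) ↔ adj 6 m i j = true) : G.Iso (ofCode m) :=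
  ⟨SimpleGraph.Iso.symm
    { toEquiv := Equiv.ofBijective f ((Fintype.bijective_iff_injective_and_card f).2
        ⟨hf, by rw [hG, Fintype.card_fin]⟩)
      map_rel_iff' := fun {i j} => h i j }⟩

open Sum in
theorem iso_codes₁ : List.Forall₂ (fun G m => G.Iso (ofCode m))
    [K 6, K 4 ∪ K 2, K 3 ∪ K 3, K 2 ∪ K 2 ∪ K 2] codes₁ := by
  refine .cons (iso_ofCode ![0, 1, 2, 3, 4, 5] _ rfl (by decide) (by decide)) <|
    .cons (iso_ofCode ![inr 0, inl 0, inl 1, inl 2, inl 3, inr 1] _ rfl (by decide)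
      (by decide)) <|
    .cons (iso_ofCode ![inl 0, inr 0, inr 1, inr 2, inl 1, inl 2] _ rfl (by decide)
      (by decide)) <|
    .cons (iso_ofCode ![inl (inl 0), inl (inr 0), inr 0, inr 1, inl (inr 1),
      inl (inl 1)] _ rfl (by decide) (by decide)) .nil

open Sum in
theorem iso_codes₂ : List.Forall₂ (fun G m => G.Iso (ofCode m))
    [K 5 ∪ K 1, K 3 ∪ K 2 ∪ K 1, C 5 ∪ K 1] codes₂ := by
  refine .cons (iso_ofCode ![inr 0, inl 0, inl 1, inl 2, inl 3, inl 4] _ rfl (by decide)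
      (by decide)) <|
    .cons (iso_ofCode ![inr 0, inl (inr 0), inl (inl 0), inl (inl 1), inl (inl 2),
      inl (inr 1)] _ rfl (by decide) (by decide)) <|
    .cons (iso_ofCode ![inr 0, inl 0, inl 2, inl 3, inl 4, inl 1] _ rfl (by decide)
      (by decide)) .nil

open Sum in
theorem iso_codes₃ : List.Forall₂ (fun G m => G.Iso (ofCode m))
    [K 4 ∪ K 1 ∪ K 1, K 2 ∪ K 2 ∪ K 1 ∪ K 1] codes₃ := by
  refine .cons (iso_ofCode ![inl (inr 0), inr 0, inl (inl 0), inl (inl 1), inl (inl 2),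
      inl (inl 3)] _ rfl (by decide) (by decide)) <|
    .cons (iso_ofCode ![inl (inr 0), inr 0, inl (inl (inl 0)), inl (inl (inr 0)),
      inl (inl (inr 1)), inl (inl (inl 1))] _ rfl (by decide) (by decide)) .nil

/-- Isomorphic graphs have equally many closed walks of length `2`, and of length `3`. These two
numbers tell the nine graphs apart. -/
theorem walks_congr {m n : ℕ} (h : (ofCode m).Iso (ofCode n)) :
    (pairing (entry m) (entry m), pairing (entry m) (entry₂ m)) =
      (pairing (entry n) (entry n), pairing (entry n) (entry₂ n)) := by
  obtain ⟨φ⟩ := h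
  let e : Fin 6 ≃ Fin 6 := φ.toEquiv
  have hA : codeMatrix m = (codeMatrix n).submatrix e e := by
    ext i j
    have h : adj 6 m i j = adj 6 n (e i) (e j) := Bool.eq_iff_iff.2 (φ.map_adj_iff (v := i)).symm
    simp [codeMatrix, entry, h]
  have h2 : (pairing (entry m) (entry m) : ℝ) = pairing (entry n) (entry n) := by
    simp only [cast_pairing, of_entry, hA, Matrix.submatrix_mul_equiv]
    exact Equiv.sum_comp e fun i => (codeMatrix n * codeMatrix n) i i
  have h3 : (pairing (entry m) (entry₂ m) : ℝ) = pairing (entry n) (entry₂ n) := by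
    simp only [cast_pairing, of_entry, of_entry₂, hA, Matrix.submatrix_mul_equiv]
    exact Equiv.sum_comp e fun i => (codeMatrix n * (codeMatrix n * codeMatrix n)) i i
  exact Prod.ext (by exact_mod_cast h2) (by exact_mod_cast h3)

theorem pairwise_not_iso {L : List FinGraph} {l : List ℕ}
    (h : List.Forall₂ (fun G m => G.Iso (ofCode m)) L l)
    (hl : l.Pairwise fun m n => (pairing (entry m) (entry m), pairing (entry m) (entry₂ m)) ≠
      (pairing (entry n) (entry n), pairing (entry n) (entry₂ n))) :
    L.Pairwise fun G H => ¬ G.Iso H := by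
  induction h with
  | nil => exact .nil
  | @cons G m L l hG h ih =>
    rw [List.pairwise_cons] at hl ⊢
    refine ⟨fun H hH hiso => ?_, ih hl.2⟩
    obtain ⟨n, hn, hHn⟩ : ∃ n ∈ l, H.Iso (ofCode n) := by
      obtain ⟨i, hi, rfl⟩ := List.getElem_of_mem hH
      exact ⟨l[i]'(h.length_eq ▸ hi), List.getElem_mem _, h.get hi _⟩
    exact hl.1 n hn (walks_congr (iso_trans (iso_symm hG) (iso_trans hiso hHn)))

/-- A list of graphs whose codes are all the codes in a class describes, up to isomorphism, the
graphs of order `6` with the local energy `v` of that class. -/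
theorem mem_upToIso_iff {L : List FinGraph} {l : List ℕ} {v : ℕ}
    (h : List.Forall₂ (fun G m => G.Iso (ofCode m)) L l)
    (hv : ∀ m ∈ l, (ofCode m).localEnergy = v) {c : ℕ} (hc : c ∈ l) (hcr : c ∈ reps 6)
    (hl : ∀ m, sameClass m c = true → m ∈ l) (F : FinGraph) :
    F ∈ upToIso L ↔ F.order = 6 ∧ F.localEnergy = v := by
  have key : F ∈ upToIso L ↔ ∃ m ∈ l, F.Iso (ofCode m) := by
    clear hv hc hl
    induction h with
    | nil => simp [upToIso]
    | @cons G m L l hG h ih =>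
      have h1 : F ∈ upToIso (G :: L) ↔ F.Iso G ∨ F ∈ upToIso L := by
        simp [upToIso]
      rw [h1, ih, List.exists_mem_cons_iff]
      exact or_congr ⟨fun h => iso_trans h hG, fun h => iso_trans h (iso_symm hG)⟩ Iff.rfl
  rw [key]
  constructor
  · rintro ⟨m, hm, hF⟩
    exact ⟨order_congr hF, (localEnergy_congr hF).trans (hv m hm)⟩
  · rintro ⟨hF, hFv⟩
    obtain ⟨m, hm, hFm⟩ := exists_iso_ofCode F hF
    refine ⟨m, ?_, hFm⟩
    have : (ofCode m).localEnergy = (ofCode c).localEnergy := by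
      rw [← localEnergy_congr hFm, hFv, hv c hc]
    rcases eq_or_sameClass hm hcr this with rfl | h
    · exact hc
    · exact hl m h

theorem mem_upToIso₁ (F : FinGraph) : F ∈ upToIso [K 6, K 4 ∪ K 2, K 3 ∪ K 3, K 2 ∪ K 2 ∪ K 2] ↔
    F.order = 6 ∧ F.localEnergy = (12 : ℕ) :=
  mem_upToIso_iff iso_codes₁ localEnergy_codes.1 (c := 656) (by decide)
    (mem_reps_of_mem_codes (by decide))
    (fun m hm => by simpa [sameClass, codes₁, codes₂, codes₃] using hm) F

theorem mem_upToIso₂ (F : FinGraph) : F ∈ upToIso [K 5 ∪ K 1, K 3 ∪ K 2 ∪ K 1, C 5 ∪ K 1] ↔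
    F.order = 6 ∧ F.localEnergy = (10 : ℕ) :=
  mem_upToIso_iff iso_codes₂ localEnergy_codes.2.1 (c := 684) (by decide)
    (mem_reps_of_mem_codes (by decide))
    (fun m hm => by simpa [sameClass, codes₁, codes₂, codes₃] using hm) F

theorem mem_upToIso₃ (F : FinGraph) : F ∈ upToIso [K 4 ∪ K 1 ∪ K 1, K 2 ∪ K 2 ∪ K 1 ∪ K 1] ↔
    F.order = 6 ∧ F.localEnergy = (8 : ℕ) :=
  mem_upToIso_iff iso_codes₃ localEnergy_codes.2.2 (c := 36) (by decide)
    (mem_reps_of_mem_codes (by decide))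
    (fun m hm => by simpa [sameClass, codes₁, codes₂, codes₃] using hm) F

theorem pairwise_nine : [K 6, K 4 ∪ K 2, K 3 ∪ K 3, K 2 ∪ K 2 ∪ K 2,
    K 5 ∪ K 1, K 3 ∪ K 2 ∪ K 1, C 5 ∪ K 1,
    K 4 ∪ K 1 ∪ K 1, K 2 ∪ K 2 ∪ K 1 ∪ K 1].Pairwise (fun G H => ¬ G.Iso H) :=
  pairwise_not_iso (List.rel_append (List.rel_append iso_codes₁ iso_codes₂) iso_codes₃)
    (by decide +kernel)

/-- A set of graphs of order `6` given by the value of the local energy is a class as soon as it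
contains two graphs that are not isomorphic. -/
theorem isLocallyEquienergeticClass_of {S : Set FinGraph} {v : ℕ}
    (hS : ∀ F, F ∈ S ↔ F.order = 6 ∧ F.localEnergy = v) {G H : FinGraph} (hG : G ∈ S) (hH : H ∈ S)
    (hGH : ¬ G.Iso H) : IsLocallyEquienergeticClass 6 S := by
  refine ⟨G, ((hS G).1 hG).1, Set.ext fun F => ?_, H, hH, fun h => hGH (iso_symm h)⟩
  rw [hS, Set.mem_ofPred_eq, LocallyEquienergetic, ((hS G).1 hG).1, ((hS G).1 hG).2]

/-- A class of order `6` consists of all graphs with one of the three local energies. -/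
theorem eq_of_isLocallyEquienergeticClass {S : Set FinGraph}
    (h : IsLocallyEquienergeticClass 6 S) :
    ∃ v ∈ [12, 10, 8], ∀ F, F ∈ S ↔ F.order = 6 ∧ F.localEnergy = (v : ℕ) := by
  obtain ⟨G, hG, rfl, H, ⟨hHo, hHe⟩, hHG⟩ := h
  obtain ⟨m, hm, hGm⟩ := exists_iso_ofCode G hG
  obtain ⟨n, hn, hHn⟩ := exists_iso_ofCode H (hHo.trans hG)
  have he : (ofCode n).localEnergy = (ofCode m).localEnergy := by
    rw [← localEnergy_congr hHn, ← localEnergy_congr hGm, hHe]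
  have hmn : n ≠ m := by
    rintro rfl
    exact hHG (iso_trans hHn (iso_symm hGm))
  have hcls := (eq_or_sameClass hn hm he).resolve_left hmn
  have hv : ∃ v ∈ [12, 10, 8], (ofCode m).localEnergy = (v : ℕ) := by
    simp only [sameClass, List.any_cons, List.any_nil, Bool.or_false, Bool.or_eq_true,
      Bool.and_eq_true, List.contains_iff_mem] at hcls
    rcases hcls with h | h | h
    · exact ⟨12, by simp, localEnergy_codes.1 m h.2⟩
    · exact ⟨10, by simp, localEnergy_codes.2.1 m h.2⟩
    · exact ⟨8, by simp, localEnergy_codes.2.2 m h.2⟩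
  obtain ⟨v, hv, hmv⟩ := hv
  refine ⟨v, hv, fun F => ?_⟩
  rw [Set.mem_ofPred_eq, LocallyEquienergetic, hG, localEnergy_congr hGm, hmv]

end SixVertex

theorem mainTheorem7 :
    {S : Set FinGraph | IsLocallyEquienergeticClass 6 S} =
        {upToIso [K 6, K 4 ∪ K 2, K 3 ∪ K 3, K 2 ∪ K 2 ∪ K 2],
          upToIso [K 5 ∪ K 1, K 3 ∪ K 2 ∪ K 1, C 5 ∪ K 1],
          upToIso [K 4 ∪ K 1 ∪ K 1, K 2 ∪ K 2 ∪ K 1 ∪ K 1]} ∧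
      {S : Set FinGraph | IsLocallyEquienergeticClass 6 S}.ncard = 3 ∧
      [K 6, K 4 ∪ K 2, K 3 ∪ K 3, K 2 ∪ K 2 ∪ K 2,
        K 5 ∪ K 1, K 3 ∪ K 2 ∪ K 1, C 5 ∪ K 1,
        K 4 ∪ K 1 ∪ K 1, K 2 ∪ K 2 ∪ K 1 ∪ K 1].Pairwise (fun G H => ¬ G.Iso H) := by
  have hrefl : ∀ G : FinGraph, G.Iso G := fun G => ⟨SimpleGraph.Iso.refl⟩
  have hmem : ∀ {L : List FinGraph} {G : FinGraph}, G ∈ L → G ∈ upToIso L :=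
    fun {L G} h => ⟨G, h, hrefl G⟩
  have hset : {S : Set FinGraph | IsLocallyEquienergeticClass 6 S} =
        {upToIso [K 6, K 4 ∪ K 2, K 3 ∪ K 3, K 2 ∪ K 2 ∪ K 2],
          upToIso [K 5 ∪ K 1, K 3 ∪ K 2 ∪ K 1, C 5 ∪ K 1],
          upToIso [K 4 ∪ K 1 ∪ K 1, K 2 ∪ K 2 ∪ K 1 ∪ K 1]} := by
    have hpw := SixVertex.pairwise_nine
    simp only [List.pairwise_cons, List.mem_cons, forall_eq_or_imp] at hpw
    ext S
    simp only [Set.mem_ofPred_eq, Set.mem_insert_iff, Set.mem_singleton_iff]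
    constructor
    · intro hS
      obtain ⟨v, hv, h⟩ := SixVertex.eq_of_isLocallyEquienergeticClass hS
      simp only [List.mem_cons, List.not_mem_nil, or_false] at hv
      rcases hv with rfl | rfl | rfl
      · exact Or.inl (Set.ext fun F => (h F).trans (SixVertex.mem_upToIso₁ F).symm)
      · exact Or.inr (Or.inl (Set.ext fun F => (h F).trans (SixVertex.mem_upToIso₂ F).symm))
      · exact Or.inr (Or.inr (Set.ext fun F => (h F).trans (SixVertex.mem_upToIso₃ F).symm))
    · rintro (rfl | rfl | rfl)
      · exact SixVertex.isLocallyEquienergeticClass_of SixVertex.mem_upToIso₁ (G := K 6)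
          (H := K 4 ∪ K 2)
          (hmem (by simp)) (hmem (by simp)) hpw.1.1
      · exact SixVertex.isLocallyEquienergeticClass_of SixVertex.mem_upToIso₂ (G := K 5 ∪ K 1)
          (H := K 3 ∪ K 2 ∪ K 1) (hmem (by simp)) (hmem (by simp)) hpw.2.2.2.2.1.1
      · exact SixVertex.isLocallyEquienergeticClass_of SixVertex.mem_upToIso₃ (G := K 4 ∪ K 1 ∪ K 1)
          (H := K 2 ∪ K 2 ∪ K 1 ∪ K 1) (hmem (by simp)) (hmem (by simp))
          hpw.2.2.2.2.2.2.2.1.1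
  refine ⟨hset, ?_, SixVertex.pairwise_nine⟩
  have hne : ∀ {S T : Set FinGraph} {v w : ℕ}, (∀ F, F ∈ S ↔ F.order = 6 ∧ F.localEnergy = v) →
      (∀ F, F ∈ T ↔ F.order = 6 ∧ F.localEnergy = w) → v ≠ w → S.Nonempty → S ≠ T := by
    rintro S T v w hS hT hvw ⟨G, hG⟩ rfl
    exact hvw (by exact_mod_cast ((hS G).1 hG).2.symm.trans ((hT G).1 hG).2)
  rw [hset]
  exact Set.ncard_eq_three.2 ⟨_, _, _,
    hne SixVertex.mem_upToIso₁ SixVertex.mem_upToIso₂ (by norm_num)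
      ⟨_, hmem (List.mem_cons_self ..)⟩,
    hne SixVertex.mem_upToIso₁ SixVertex.mem_upToIso₃ (by norm_num)
      ⟨_, hmem (List.mem_cons_self ..)⟩,
    hne SixVertex.mem_upToIso₂ SixVertex.mem_upToIso₃ (by norm_num)
      ⟨_, hmem (List.mem_cons_self ..)⟩,
    rfl⟩
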